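/- Let $(N,h)$ be a Riemannian manifold (smooth, without boundary, not necessarily complete) with non-positive sectional curvature. Let $(M^m,g)$ be a compact Riemannian manifold without boundary, and let $\phi:(M,g)\to(N,h)$ be a smooth isometric immersion. Let $\mathbf H=\frac1m\sum_{i=1}^m B(e_i,e_i)$ be its mean curvature vector field, where $B(X,Y)=\nabla^N_XY-\nabla_XY$ is the second fundamental form and $\{e_i\}_{i=1}^m$ is a local orthonormal frame of $M$. Suppose that $M$ is a non-negative biminimal submanifold of $N$, that is, for some real constant $\lambda\ge 0$, $$\Big[-\Delta^\phi\mathbf H-\sum_{i=1}^m R^N(\mathbf H,d\phi(e_i))\,d\phi(e_i)\Big]^\perp+\lambda\,\mathbf H=0\quad\text{on } M .$$ Here $\Delta^\phi=\sum_{i=1}^m\big(\nabla^\phi_{e_i}\nabla^\phi_{e_i}-\nabla^\phi_{\nabla_{e_i}e_i}\big)$, $\nabla^\phi$ is the connection induced on $\phi^*TN$ by the Levi-Civita connection $\nabla^N$ of $N$, $R^N(X,Y)Z=[\nabla^N_X,\nabla^N_Y]Z-\nabla^N_{[X,Y]}Z$, and $[\,\cdot\,]^\perp$ is the component normal to $d\phi(TM)$.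 Then $M$ is minimal, that is, $\mathbf H=0$ on $M$. -/

import Mathlib

open Bundle
open scoped Manifold ContDiff

noncomputable section

namespace Biminimal

section Riemannian

/-! Riemannian manifolds are smooth manifolds without boundary, modelled on `ℝ^n`, with a smooth
Riemannian metric on the tangent bundle. -/

variable {n : ℕ} {N : Type*} [TopologicalSpace N] [ChartedSpace (EuclideanSpace ℝ (Fin n)) N]
  [IsManifold (𝓡 n) ∞ N]

instance (q : N) : FiniteDimensional ℝ (TangentSpace (𝓡 n) q) :=
  inferInstanceAs (FiniteDimensional ℝ (EuclideanSpace ℝ (Fin n)))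

/-- The vector field which extends `u ∈ T_q N` and has constant components `u^i ∂_i` in the
coordinates given by the preferred chart at `q`, on the domain of that chart. -/
def coordField {q : N} (u : TangentSpace (𝓡 n) q) (p : N) : TangentSpace (𝓡 n) p :=
  FiberBundle.extend (EuclideanSpace ℝ (Fin n)) u p

variable [RiemannianBundle (fun q : N ↦ TangentSpace (𝓡 n) q)]

/-- `D_u ⟨W, Z⟩` at `q`, where `W`, `Z` are the coordinate-constant extensions of `w`, `z`. -/
def metricDeriv {q : N} (u w z : TangentSpace (𝓡 n) q) : ℝ :=
  mvfderiv (𝓡 n) (fun p : N ↦ (inner ℝ (coordField w p) (coordField z p) : ℝ)) q u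

/-- The Christoffel symbols of the Levi-Civita connection in the preferred chart at `q`, at the
point `q`. This is `Γ(u, w) = ∇_u W` for the coordinate-constant extension `W` of `w`. It is given by
the Koszul formula (coordinate fields commute)
`2 ⟨Γ(u, w), z⟩ = D_u ⟨W, Z⟩ + D_w ⟨U, Z⟩ - D_z ⟨U, W⟩`. -/
def christoffel {q : N} (u w : TangentSpace (𝓡 n) q) : TangentSpace (𝓡 n) q :=
  let e := stdOrthonormalBasis ℝ (TangentSpace (𝓡 n) q)
  ∑ k, ((metricDeriv u w (e k) + metricDeriv w u (e k) - metricDeriv (e k) u w) / 2) • e k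

variable {m : ℕ} {M : Type*} [TopologicalSpace M] [ChartedSpace (EuclideanSpace ℝ (Fin m)) M]
  [IsManifold (𝓡 m) ∞ M]

/-- The connection `∇^φ` induced on `φ^* TN` by the Levi-Civita connection of `N`:
`∇^φ_v W = dW^k(v) ∂_k + Γ(dφ(v), W)` for a section `W` of `φ^* TN` and `v ∈ T_x M`, in the
preferred chart of `N` at `φ x`. -/
def covDerivAlong (φ : M → N) (W : ∀ y : M, TangentSpace (𝓡 n) (φ y)) {x : M}
    (v : TangentSpace (𝓡 m) x) : TangentSpace (𝓡 n) (φ x) :=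
  let t := trivializationAt (EuclideanSpace ℝ (Fin n)) (TangentSpace (𝓡 n) : N → Type _) (φ x)
  t.symmL ℝ (φ x) (mvfderiv (𝓡 m) (fun y : M ↦ t.continuousLinearMapAt ℝ (φ y) (W y)) x v)
    + christoffel (mfderiv (𝓡 m) (𝓡 n) φ x v) (W x)

/-- The Levi-Civita connection: `leviCivita Y u = ∇_u Y`. -/
def leviCivita (Y : ∀ p : N, TangentSpace (𝓡 n) p) {q : N} (u : TangentSpace (𝓡 n) q) :
    TangentSpace (𝓡 n) q :=
  covDerivAlong (m := n) (M := N) (fun p ↦ p) Y u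

/-- The Riemann curvature `R(u, v)w`, that is `∇_U ∇_V W - ∇_V ∇_U W - ∇_[U, V] W` for the
coordinate-constant extensions of `u`, `v`, `w`, for which `[U, V] = 0` near `q`. -/
def curvature {q : N} (u v w : TangentSpace (𝓡 n) q) : TangentSpace (𝓡 n) q :=
  leviCivita (fun p ↦ leviCivita (coordField w) (coordField v p)) u
    - leviCivita (fun p ↦ leviCivita (coordField w) (coordField u p)) v

/-- The sectional curvature of the plane spanned by linearly independent `u`, `v`. -/
def sectionalCurvature {q : N} (u v : TangentSpace (𝓡 n) q) : ℝ :=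
  inner ℝ (curvature u v v) u / (‖u‖ ^ 2 * ‖v‖ ^ 2 - (inner ℝ u v) ^ 2)

variable (n N) in
/-- All sectional curvatures of `N` are non-positive. -/
def NonposSectionalCurvature : Prop :=
  ∀ (q : N) (u v : TangentSpace (𝓡 n) q), LinearIndependent ℝ ![u, v] →
    sectionalCurvature u v ≤ 0

end Riemannian

section Immersion

variable {m n : ℕ}
  {M : Type*} [TopologicalSpace M] [ChartedSpace (EuclideanSpace ℝ (Fin m)) M]
  [IsManifold (𝓡 m) ∞ M] [RiemannianBundle (fun x : M ↦ TangentSpace (𝓡 m) x)]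
  {N : Type*} [TopologicalSpace N] [ChartedSpace (EuclideanSpace ℝ (Fin n)) N]
  [IsManifold (𝓡 n) ∞ N] [RiemannianBundle (fun q : N ↦ TangentSpace (𝓡 n) q)]

variable (m n) in
/-- Smooth isometric immersions; `dφ_x` is injective because it preserves the metric. -/
structure IsIsometricImmersion (φ : M → N) : Prop where
  contMDiff : ContMDiff (𝓡 m) (𝓡 n) ∞ φ
  inner_mfderiv : ∀ (x : M) (u v : TangentSpace (𝓡 m) x),
    (inner ℝ (mfderiv (𝓡 m) (𝓡 n) φ x u) (mfderiv (𝓡 m) (𝓡 n) φ x v) : ℝ) = inner ℝ u v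

/-- The second fundamental form, by the Gauss formula: `B(u, v) = ∇^N_u V - ∇_u V`, where the
tangent field `V` is identified with the section `dφ(V)` of `φ^* TN`. -/
def secondFundamentalForm (φ : M → N) {x : M} (u v : TangentSpace (𝓡 m) x) :
    TangentSpace (𝓡 n) (φ x) :=
  covDerivAlong φ (fun y ↦ mfderiv (𝓡 m) (𝓡 n) φ y (coordField v y)) u
    - mfderiv (𝓡 m) (𝓡 n) φ x (leviCivita (coordField v) u)

variable (m n) in
/-- The mean curvature vector field `H = (1/m) ∑ B(e_i, e_i)`, for an orthonormal basis `e_i` of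
`T_x M`. -/
def meanCurvature (φ : M → N) (x : M) : TangentSpace (𝓡 n) (φ x) :=
  let e := stdOrthonormalBasis ℝ (TangentSpace (𝓡 m) x)
  (1 / (m : ℝ)) • ∑ i, secondFundamentalForm φ (e i) (e i)

variable (m n) in
/-- `M` is minimal when its mean curvature vector field vanishes. -/
def IsMinimal (φ : M → N) : Prop :=
  ∀ x : M, meanCurvature m n φ x = 0

/-- The second covariant derivative `∇^φ_U ∇^φ_V W - ∇^φ_(∇_U V) W` of a section `W` of `φ^* TN`.
It is tensorial in `u`, `v`; the coordinate-constant extension `V` of `v` is used. -/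
def secondCovDerivAlong (φ : M → N) (W : ∀ y : M, TangentSpace (𝓡 n) (φ y)) {x : M}
    (u v : TangentSpace (𝓡 m) x) : TangentSpace (𝓡 n) (φ x) :=
  covDerivAlong φ (fun y ↦ covDerivAlong φ W (coordField v y)) u
    - covDerivAlong φ W (leviCivita (coordField v) u)

variable (m n) in
/-- The rough Laplacian `Δ^φ W = ∑ (∇^φ_{e_i} ∇^φ_{e_i} - ∇^φ_{∇_{e_i} e_i}) W`. -/
def laplacianAlong (φ : M → N) (W : ∀ y : M, TangentSpace (𝓡 n) (φ y)) (x : M) :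
    TangentSpace (𝓡 n) (φ x) :=
  let e := stdOrthonormalBasis ℝ (TangentSpace (𝓡 m) x)
  ∑ i, secondCovDerivAlong φ W (e i) (e i)

variable (m n) in
/-- The orthogonal projection `w ↦ w^⊥` of `T_{φ(x)} N` onto the normal space
`dφ(T_x M)^⊥`. -/
def normalPart (φ : M → N) (x : M) (w : TangentSpace (𝓡 n) (φ x)) : TangentSpace (𝓡 n) (φ x) :=
  (LinearMap.range (mfderiv (𝓡 m) (𝓡 n) φ x).toLinearMap)ᗮ.starProjection w

variable (m n) in
/-- An isometric immersion `φ` makes `M` a biminimal submanifold of `N` with constant `l` when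
`[-Δ^φ H - ∑ R^N(H, dφ(e_i)) dφ(e_i)]^⊥ + l H = 0`. -/
structure IsBiminimalSubmanifold (φ : M → N) (l : ℝ) : Prop where
  isIsometricImmersion : IsIsometricImmersion m n φ
  biminimal_eq : ∀ x : M,
    let e := stdOrthonormalBasis ℝ (TangentSpace (𝓡 m) x)
    normalPart m n φ x (-laplacianAlong m n φ (meanCurvature m n φ) x
      - ∑ i, curvature (meanCurvature m n φ x) (mfderiv (𝓡 m) (𝓡 n) φ x (e i))
          (mfderiv (𝓡 m) (𝓡 n) φ x (e i)))
      + l • meanCurvature m n φ x = 0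

variable (m n) in
/-- Non-negative biminimal submanifolds: biminimal with some constant `l ≥ 0`. -/
def IsNonnegBiminimalSubmanifold (φ : M → N) : Prop :=
  ∃ l : ℝ, 0 ≤ l ∧ IsBiminimalSubmanifold m n φ l

end Immersion

end Biminimal

end

/-! At a maximum point `x₀` of `|H|²`, the Bochner formula gives
`⟨Δ^φ H, H⟩ + ∑ |∇^φ_{e_i} H|² ≤ 0`. Pairing the biminimal equation with the normal vector `H`
gives `⟨Δ^φ H, H⟩ = l |H|² - ∑ ⟨R^N(H, dφ(e_i)) dφ(e_i), H⟩ ≥ 0`, so `∇^φ H = 0` at `x₀`.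
Differentiating `⟨H, dφ(e_i)⟩ = 0` along `e_i` then gives
`⟨H, B(e_i, e_i)⟩ = -⟨∇^φ_{e_i} H, dφ(e_i)⟩ = 0` at `x₀`, and summing over `i` yields
`|H(x₀)|² = 0`.
-/

noncomputable section

namespace Biminimal

open Filter
open scoped Topology

section SecondDerivativeTest

lemma deriv_deriv_nonpos_of_isLocalMax {g : ℝ → ℝ} {t : ℝ} (h : IsLocalMax g t)
    (hg : ContinuousAt g t) : deriv (deriv g) t ≤ 0 := by
  by_contra! hpos
  have hmin : IsLocalMin g t := isLocalMin_of_deriv_deriv_pos hpos h.deriv_eq_zero hg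
  have hconst : g =ᶠ[𝓝 t] fun _ ↦ g t := by
    filter_upwards [h, hmin] with s hle hge using le_antisymm hle hge
  have hderiv : deriv g =ᶠ[𝓝 t] fun _ ↦ 0 := by simpa using hconst.deriv
  simp [hderiv.deriv_eq] at hpos

lemma fderiv_fderiv_nonpos_of_isLocalMax {E : Type*} [NormedAddCommGroup E] [NormedSpace ℝ E]
    {h : E → ℝ} {p : E} (hmax : IsLocalMax h p) (hh : ContDiffAt ℝ 2 h p) (v : E) :
    fderiv ℝ (fderiv ℝ h) p v v ≤ 0 := by
  let c : ℝ → E := fun t ↦ p + t • v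
  have hc (t : ℝ) : HasDerivAt c v t := by
    simpa [c] using ((hasDerivAt_id t).smul_const v).const_add p
  have hp : c 0 = p := by simp [c]
  rw [← hp] at hmax hh ⊢
  have hderiv : deriv (h ∘ c) =ᶠ[𝓝 0] fun t ↦ fderiv ℝ h (c t) v := by
    filter_upwards [(hc 0).continuousAt.eventually (hh.eventually (by simp))] with t ht
    exact ((ht.differentiableAt (by simp)).hasFDerivAt.comp_hasDerivAt t (hc t)).deriv
  have hfderiv : DifferentiableAt ℝ (fderiv ℝ h) (c 0) :=
    (hh.fderiv_right (m := 1) (by norm_num)).differentiableAt (by simp)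
  have hderiv₂ : deriv (deriv (h ∘ c)) 0 = fderiv ℝ (fderiv ℝ h) (c 0) v v := by
    rw [hderiv.deriv_eq]
    simpa using ((hfderiv.hasFDerivAt.comp_hasDerivAt 0 (hc 0)).clm_apply
      (hasDerivAt_const 0 v)).deriv
  rw [← hderiv₂]
  exact deriv_deriv_nonpos_of_isLocalMax (hmax.comp_continuous (hc 0).continuousAt)
    (hh.continuousAt.comp (hc 0).continuousAt)

end SecondDerivativeTest

lemma mvfderiv_congr {𝕜 E H M F : Type*} [NontriviallyNormedField 𝕜] [NormedAddCommGroup E]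
    [NormedSpace 𝕜 E] [TopologicalSpace H] {I : ModelWithCorners 𝕜 E H} [TopologicalSpace M]
    [ChartedSpace H M] [NormedAddCommGroup F] [NormedSpace 𝕜 F] {f g : M → F} {x : M}
    (h : f =ᶠ[𝓝 x] g) : mvfderiv I f x = mvfderiv I g x := by
  ext v
  simp only [mvfderiv, h.mfderiv_eq]
  rfl

section CoordinateFields

variable {n : ℕ} {N : Type*} [TopologicalSpace N] [ChartedSpace (EuclideanSpace ℝ (Fin n)) N]
  [IsManifold (𝓡 n) ∞ N] {q p : N}

/-- The components of tangent vectors at `p` with respect to the preferred chart at `q`. -/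
def chartCoord (q p : N) : TangentSpace (𝓡 n) p →L[ℝ] EuclideanSpace ℝ (Fin n) :=
  (trivializationAt (EuclideanSpace ℝ (Fin n)) (TangentSpace (𝓡 n) : N → Type _)
    q).continuousLinearMapAt ℝ p

/-- The tangent vector at `p` with given components with respect to the preferred chart at `q`. -/
def chartVec (q p : N) : EuclideanSpace ℝ (Fin n) →L[ℝ] TangentSpace (𝓡 n) p :=
  (trivializationAt (EuclideanSpace ℝ (Fin n)) (TangentSpace (𝓡 n) : N → Type _) q).symmL ℝ p

lemma chartVec_chartCoord (hp : p ∈ (chartAt (EuclideanSpace ℝ (Fin n)) q).source)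
    (v : TangentSpace (𝓡 n) p) : chartVec q p (chartCoord q p v) = v :=
  Trivialization.symmL_continuousLinearMapAt _ (by simpa using hp) v

lemma chartCoord_chartVec (hp : p ∈ (chartAt (EuclideanSpace ℝ (Fin n)) q).source)
    (a : EuclideanSpace ℝ (Fin n)) : chartCoord q p (chartVec q p a) = a :=
  Trivialization.continuousLinearMapAt_symmL _ (by simpa using hp) a

lemma coordField_eq_chartVec (u : TangentSpace (𝓡 n) q)
    (hp : p ∈ (chartAt (EuclideanSpace ℝ (Fin n)) q).source) :
    coordField u p = chartVec q p (chartCoord q q u) := by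
  have hu : chartCoord q q u = (trivializationAt (EuclideanSpace ℝ (Fin n))
      (TangentSpace (𝓡 n) : N → Type _) q ⟨q, u⟩).2 := by
    rw [chartCoord, Trivialization.continuousLinearMapAt_apply,
      Trivialization.coe_linearMapAt_of_mem _ (by simp)]
  rw [hu, coordField, FiberBundle.extend, chartVec,
    Trivialization.symmL_apply _ (by simpa using hp)]

lemma chartCoord_coordField (u : TangentSpace (𝓡 n) q)
    (hp : p ∈ (chartAt (EuclideanSpace ℝ (Fin n)) q).source) :
    chartCoord q p (coordField u p) = chartCoord q q u := by
  rw [coordField_eq_chartVec u hp, chartCoord_chartVec hp]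

lemma coordField_self (u : TangentSpace (𝓡 n) q) : coordField u q = u :=
  FiberBundle.extend_apply_self _ u

lemma coordField_add (u v : TangentSpace (𝓡 n) q)
    (hp : p ∈ (chartAt (EuclideanSpace ℝ (Fin n)) q).source) :
    coordField (u + v) p = coordField u p + coordField v p := by
  simp only [coordField_eq_chartVec _ hp, map_add]

lemma coordField_smul (c : ℝ) (u : TangentSpace (𝓡 n) q)
    (hp : p ∈ (chartAt (EuclideanSpace ℝ (Fin n)) q).source) :
    coordField (c • u) p = c • coordField u p := by
  simp only [coordField_eq_chartVec _ hp, map_smul]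

lemma mfderiv_extChartAt_coordField (u : TangentSpace (𝓡 n) q)
    (hp : p ∈ (chartAt (EuclideanSpace ℝ (Fin n)) q).source) :
    mfderiv (𝓡 n) 𝓘(ℝ, EuclideanSpace ℝ (Fin n)) (extChartAt (𝓡 n) q) p (coordField u p)
      = chartCoord q q u := by
  rw [← chartCoord_coordField u hp, chartCoord,
    TangentBundle.continuousLinearMapAt_trivializationAt hp]
  rfl

variable {F : Type*} [NormedAddCommGroup F] [NormedSpace ℝ F] {f : N → F}

lemma mvfderiv_comp_extChartAt_coordField {g : EuclideanSpace ℝ (Fin n) → F}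
    (hp : p ∈ (chartAt (EuclideanSpace ℝ (Fin n)) q).source)
    (hg : DifferentiableAt ℝ g (extChartAt (𝓡 n) q p)) (u : TangentSpace (𝓡 n) q) :
    mvfderiv (𝓡 n) (fun z ↦ g (extChartAt (𝓡 n) q z)) p (coordField u p)
      = fderiv ℝ g (extChartAt (𝓡 n) q p) (chartCoord q q u) := by
  rw [← mfderiv_extChartAt_coordField u hp, ← mfderiv_eq_fderiv]
  exact mfderiv_comp_apply (I' := 𝓘(ℝ, EuclideanSpace ℝ (Fin n))) p hg.mdifferentiableAt
    (mdifferentiableAt_extChartAt hp) (coordField u p)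

lemma contDiffAt_comp_extChartAt_symm {k : WithTop ℕ∞} (hk : k ≤ ∞)
    (hf : ContMDiffAt (𝓡 n) 𝓘(ℝ, F) k f p)
    (hp : p ∈ (chartAt (EuclideanSpace ℝ (Fin n)) q).source) :
    ContDiffAt ℝ k (f ∘ (extChartAt (𝓡 n) q).symm) (extChartAt (𝓡 n) q p) := by
  have hp' : p ∈ (extChartAt (𝓡 n) q).source := by simpa using hp
  rw [← contMDiffAt_iff_contDiffAt]
  refine ContMDiffAt.comp (I' := 𝓡 n) _ ?_
    (((contMDiffOn_extChartAt_symm (n := ∞) q).contMDiffAt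
      ((isOpen_extChartAt_target q).mem_nhds ((extChartAt (𝓡 n) q).map_source hp'))).of_le hk)
  rwa [(extChartAt (𝓡 n) q).left_inv hp']

lemma mvfderiv_coordField (hf : ContMDiffAt (𝓡 n) 𝓘(ℝ, F) 1 f p)
    (hp : p ∈ (chartAt (EuclideanSpace ℝ (Fin n)) q).source) (u : TangentSpace (𝓡 n) q) :
    mvfderiv (𝓡 n) f p (coordField u p)
      = fderiv ℝ (f ∘ (extChartAt (𝓡 n) q).symm) (extChartAt (𝓡 n) q p) (chartCoord q q u) := by
  have hfq := contDiffAt_comp_extChartAt_symm ENat.LEInfty.out hf hp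
  have hfχ : f =ᶠ[𝓝 p] fun z ↦ (f ∘ (extChartAt (𝓡 n) q).symm) (extChartAt (𝓡 n) q z) := by
    filter_upwards [extChartAt_source_mem_nhds' (I := 𝓡 n) (by simpa using hp)] with z hz
    rw [Function.comp_apply, (extChartAt (𝓡 n) q).left_inv hz]
  rw [mvfderiv_congr hfχ, mvfderiv_comp_extChartAt_coordField hp (hfq.differentiableAt (by simp))]

lemma mvfderiv_mvfderiv_coordField (hf : ContMDiffAt (𝓡 n) 𝓘(ℝ, F) 2 f p)
    (hp : p ∈ (chartAt (EuclideanSpace ℝ (Fin n)) q).source) (u v : TangentSpace (𝓡 n) q) :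
    mvfderiv (𝓡 n) (fun z ↦ mvfderiv (𝓡 n) f z (coordField u z)) p (coordField v p)
      = fderiv ℝ (fderiv ℝ (f ∘ (extChartAt (𝓡 n) q).symm)) (extChartAt (𝓡 n) q p)
          (chartCoord q q v) (chartCoord q q u) := by
  have hfderiv := ((contDiffAt_comp_extChartAt_symm ENat.LEInfty.out hf hp).fderiv_right (m := 1)
    (by norm_num)).differentiableAt (by simp)
  have hfirst : (fun z ↦ mvfderiv (𝓡 n) f z (coordField u z)) =ᶠ[𝓝 p] fun z ↦
      fderiv ℝ (f ∘ (extChartAt (𝓡 n) q).symm) (extChartAt (𝓡 n) q z) (chartCoord q q u) := by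
    filter_upwards [(contMDiffAt_iff_contMDiffAt_nhds (by simp)).1 hf,
      (chartAt _ q).open_source.mem_nhds hp] with z hz hzq
    exact mvfderiv_coordField (hz.of_le (by simp)) hzq u
  rw [mvfderiv_congr hfirst, mvfderiv_comp_extChartAt_coordField
    (g := fun a ↦ fderiv ℝ (f ∘ (extChartAt (𝓡 n) q).symm) a (chartCoord q q u)) hp
    (hfderiv.clm_apply (differentiableAt_const _)),
    fderiv_clm_apply hfderiv (differentiableAt_const _)]
  simp

lemma mvfderiv_mvfderiv_coordField_comm (hf : ContMDiffAt (𝓡 n) 𝓘(ℝ, F) 2 f p)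
    (hp : p ∈ (chartAt (EuclideanSpace ℝ (Fin n)) q).source) (u v : TangentSpace (𝓡 n) q) :
    mvfderiv (𝓡 n) (fun z ↦ mvfderiv (𝓡 n) f z (coordField u z)) p (coordField v p)
      = mvfderiv (𝓡 n) (fun z ↦ mvfderiv (𝓡 n) f z (coordField v z)) p (coordField u p) := by
  rw [mvfderiv_mvfderiv_coordField hf hp, mvfderiv_mvfderiv_coordField hf hp]
  exact (contDiffAt_comp_extChartAt_symm ENat.LEInfty.out hf hp).isSymmSndFDerivAt (by simp) _ _

end CoordinateFields

section LocalMaximum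

variable {m : ℕ} {M : Type*} [TopologicalSpace M] [ChartedSpace (EuclideanSpace ℝ (Fin m)) M]
  {f : M → ℝ} {x : M}

lemma isLocalMax_comp_extChartAt_symm (h : IsLocalMax f x) :
    IsLocalMax (f ∘ (extChartAt (𝓡 m) x).symm) (extChartAt (𝓡 m) x x) :=
  IsLocalMax.comp_continuous (g := (extChartAt (𝓡 m) x).symm) (by rwa [extChartAt_to_inv])
    (continuousAt_extChartAt_symm x)

lemma mvfderiv_eq_zero_of_isLocalMax (h : IsLocalMax f x) : mvfderiv (𝓡 m) f x = 0 := by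
  by_cases hf : MDifferentiableAt (𝓡 m) 𝓘(ℝ) f x
  · have hderiv := (isLocalMax_comp_extChartAt_symm (m := m) h).fderiv_eq_zero
    ext v
    rw [mvfderiv, hf.mfderiv, ModelWithCorners.Boundaryless.range_eq_univ, fderivWithin_univ]
    exact congrArg (· v) hderiv
  · rw [mvfderiv, mfderiv_zero_of_not_mdifferentiableAt hf, ContinuousLinearMap.comp_zero]

lemma mvfderiv_mvfderiv_nonpos_of_isLocalMax [IsManifold (𝓡 m) ∞ M] (h : IsLocalMax f x)
    (hf : ContMDiffAt (𝓡 m) 𝓘(ℝ) 2 f x) (v : TangentSpace (𝓡 m) x) :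
    mvfderiv (𝓡 m) (fun z ↦ mvfderiv (𝓡 m) f z (coordField v z)) x v ≤ 0 := by
  have hsecond := mvfderiv_mvfderiv_coordField hf (mem_chart_source _ x) v v
  rw [coordField_self] at hsecond
  rw [hsecond]
  exact fderiv_fderiv_nonpos_of_isLocalMax (isLocalMax_comp_extChartAt_symm h)
    (contDiffAt_comp_extChartAt_symm ENat.LEInfty.out hf (mem_chart_source _ x)) _

end LocalMaximum

section SectionsAlongMaps

variable {n : ℕ} {N : Type*} [TopologicalSpace N] [ChartedSpace (EuclideanSpace ℝ (Fin n)) N]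
  {m : ℕ} {M : Type*} [TopologicalSpace M] [ChartedSpace (EuclideanSpace ℝ (Fin m)) M]

lemma eventually_mem_chartAt_source {φ : M → N} {x : M} (hφ : ContinuousAt φ x) :
    ∀ᶠ y in 𝓝 x, φ y ∈ (chartAt (EuclideanSpace ℝ (Fin n)) (φ x)).source :=
  hφ ((chartAt _ (φ x)).open_source.mem_nhds (mem_chart_source _ _))

variable [IsManifold (𝓡 n) ∞ N]

variable (m) in
/-- The section `W` of `φ^* TN` is `C^k` at `x`, as a map from `M` to `TN`. In particular `φ` itself
is `C^k` at `x`. -/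
def ContMDiffAlongAt (k : WithTop ℕ∞) (φ : M → N) (W : ∀ y : M, TangentSpace (𝓡 n) (φ y)) (x : M) :
    Prop :=
  ContMDiffAt (𝓡 m) (𝓡 n).tangent k (fun y ↦ (⟨φ y, W y⟩ : TangentBundle (𝓡 n) N)) x

variable {k : WithTop ℕ∞} {φ : M → N} {W Z : ∀ y : M, TangentSpace (𝓡 n) (φ y)} {x : M}

lemma contMDiffAlongAt_iff_chartCoord (hφ : ContMDiffAt (𝓡 m) (𝓡 n) k φ x) :
    ContMDiffAlongAt m k φ W x ↔
      ContMDiffAt (𝓡 m) 𝓘(ℝ, EuclideanSpace ℝ (Fin n)) k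
        (fun y ↦ chartCoord (φ x) (φ y) (W y)) x := by
  rw [ContMDiffAlongAt, contMDiffAt_totalSpace, and_iff_right hφ]
  refine Filter.EventuallyEq.contMDiffAt_iff ?_
  filter_upwards [eventually_mem_chartAt_source (n := n) hφ.continuousAt] with y hy
  rw [chartCoord, Trivialization.continuousLinearMapAt_apply,
    Trivialization.coe_linearMapAt_of_mem _ (by simpa using hy)]

namespace ContMDiffAlongAt

lemma contMDiffAt_base (hW : ContMDiffAlongAt m k φ W x) : ContMDiffAt (𝓡 m) (𝓡 n) k φ x :=
  (contMDiffAt_totalSpace.1 hW).1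

lemma contMDiffAt_chartCoord (hW : ContMDiffAlongAt m k φ W x) :
    ContMDiffAt (𝓡 m) 𝓘(ℝ, EuclideanSpace ℝ (Fin n)) k
      (fun y ↦ chartCoord (φ x) (φ y) (W y)) x :=
  (contMDiffAlongAt_iff_chartCoord hW.contMDiffAt_base).1 hW

lemma congr (hW : ContMDiffAlongAt m k φ W x) (hZ : ∀ᶠ y in 𝓝 x, Z y = W y) :
    ContMDiffAlongAt m k φ Z x :=
  ContMDiffAt.congr_of_eventuallyEq hW (hZ.mono fun y hy ↦ by simp only [hy])

lemma of_le {l : WithTop ℕ∞} (hW : ContMDiffAlongAt m k φ W x) (hl : l ≤ k) :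
    ContMDiffAlongAt m l φ W x :=
  ContMDiffAt.of_le hW hl

lemma eventually [IsManifold (𝓡 m) ∞ M] (hW : ContMDiffAlongAt m 1 φ W x) :
    ∀ᶠ y in 𝓝 x, ContMDiffAlongAt m 1 φ W y :=
  (contMDiffAt_iff_contMDiffAt_nhds (n := 1) (by simp)).1 hW

lemma add (hW : ContMDiffAlongAt m k φ W x) (hZ : ContMDiffAlongAt m k φ Z x) :
    ContMDiffAlongAt m k φ (fun y ↦ W y + Z y) x := by
  rw [contMDiffAlongAt_iff_chartCoord hW.contMDiffAt_base]
  simp only [map_add]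
  exact hW.contMDiffAt_chartCoord.add hZ.contMDiffAt_chartCoord

lemma sub (hW : ContMDiffAlongAt m k φ W x) (hZ : ContMDiffAlongAt m k φ Z x) :
    ContMDiffAlongAt m k φ (fun y ↦ W y - Z y) x := by
  rw [contMDiffAlongAt_iff_chartCoord hW.contMDiffAt_base]
  simp only [map_sub]
  exact hW.contMDiffAt_chartCoord.sub hZ.contMDiffAt_chartCoord

lemma smul {f : M → ℝ} (hf : ContMDiffAt (𝓡 m) 𝓘(ℝ) k f x) (hW : ContMDiffAlongAt m k φ W x) :
    ContMDiffAlongAt m k φ (fun y ↦ f y • W y) x := by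
  rw [contMDiffAlongAt_iff_chartCoord hW.contMDiffAt_base]
  simp only [map_smul]
  exact hf.smul hW.contMDiffAt_chartCoord

lemma sum {ι : Type*} {s : Finset ι} {V : ι → ∀ y : M, TangentSpace (𝓡 n) (φ y)}
    (hφ : ContMDiffAt (𝓡 m) (𝓡 n) k φ x) (hV : ∀ i ∈ s, ContMDiffAlongAt m k φ (V i) x) :
    ContMDiffAlongAt m k φ (fun y ↦ ∑ i ∈ s, V i y) x := by
  rw [contMDiffAlongAt_iff_chartCoord hφ]
  simp only [map_sum]
  exact contMDiffAt_finsetSum fun i hi ↦ (hV i hi).contMDiffAt_chartCoord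

lemma comp {Y : ∀ p : N, TangentSpace (𝓡 n) p} (hY : ContMDiffAlongAt n k (fun p ↦ p) Y (φ x))
    (hφ : ContMDiffAt (𝓡 m) (𝓡 n) k φ x) : ContMDiffAlongAt m k φ (fun y ↦ Y (φ y)) x :=
  ContMDiffAt.comp x hY hφ

end ContMDiffAlongAt

lemma contMDiffAlongAt_coordField {q p : N} (u : TangentSpace (𝓡 n) q) (hk : k ≤ ∞)
    (hp : p ∈ (chartAt (EuclideanSpace ℝ (Fin n)) q).source) :
    ContMDiffAlongAt n k (fun p : N ↦ p) (coordField u) p := by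
  refine ContMDiffAlongAt.of_le (k := ∞) ?_ hk
  let t := trivializationAt (EuclideanSpace ℝ (Fin n)) (TangentSpace (𝓡 n) : N → Type _) q
  have hcoord : (fun p : N ↦ (t ⟨p, coordField u p⟩).2) =ᶠ[𝓝 p] fun _ ↦ chartCoord q q u := by
    filter_upwards [(chartAt _ q).open_source.mem_nhds hp] with y hy
    have ht : y ∈ t.baseSet := by simpa [t] using hy
    rw [← chartCoord_coordField u hy, chartCoord, Trivialization.continuousLinearMapAt_apply,
      Trivialization.coe_linearMapAt_of_mem _ ht]
  exact (t.contMDiffAt_section_iff (IB := 𝓡 n) (by simpa [t] using hp)).2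
    (contMDiffAt_const.congr_of_eventuallyEq hcoord)

lemma contMDiffAlongAt_coordField_comp (hφ : ContMDiffAt (𝓡 m) (𝓡 n) k φ x) (hk : k ≤ ∞)
    (u : TangentSpace (𝓡 n) (φ x)) : ContMDiffAlongAt m k φ (fun y ↦ coordField u (φ y)) x :=
  (contMDiffAlongAt_coordField u hk (mem_chart_source _ _)).comp hφ

lemma ContMDiffAlongAt.exists_eventually_eq_sum (hW : ContMDiffAlongAt m k φ W x) :
    ∃ (f : Fin n → M → ℝ) (u : Fin n → TangentSpace (𝓡 n) (φ x)),
      (∀ i, ContMDiffAt (𝓡 m) 𝓘(ℝ) k (f i) x) ∧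
        ∀ᶠ y in 𝓝 x, W y = ∑ i, f i y • coordField (u i) (φ y) := by
  let b := EuclideanSpace.basisFun (Fin n) ℝ
  refine ⟨fun i y ↦ chartCoord (φ x) (φ y) (W y) i, fun i ↦ chartVec (φ x) (φ x) (b i),
    fun i ↦ ?_, ?_⟩
  · exact (EuclideanSpace.proj (𝕜 := ℝ) i).contDiff.contMDiff.contMDiffAt.comp x
      hW.contMDiffAt_chartCoord
  · filter_upwards [eventually_mem_chartAt_source (n := n) hW.contMDiffAt_base.continuousAt]
      with y hy
    simp only [coordField_eq_chartVec _ hy, chartCoord_chartVec (mem_chart_source _ _),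
      ← map_smul, ← map_sum]
    have hsum := b.sum_repr (chartCoord (φ x) (φ y) (W y))
    simp only [b, EuclideanSpace.basisFun_repr] at hsum
    rw [hsum, chartVec_chartCoord hy]

/-- Germs of sections of `φ^* TN` at `x` are generated by the coordinate fields at `φ x`. -/
@[elab_as_elim]
lemma ContMDiffAlongAt.induction {P : ∀ W, ContMDiffAlongAt m k φ W x → Prop} (hk : k ≤ ∞)
    (coordField : ∀ u hu, P (fun y ↦ coordField (q := φ x) u (φ y)) hu)
    (add : ∀ W Z hW hZ, P W hW → P Z hZ → P (fun y ↦ W y + Z y) (hW.add hZ))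
    (smul : ∀ (f : M → ℝ) W (hf : ContMDiffAt (𝓡 m) 𝓘(ℝ) k f x) hW, P W hW →
      P (fun y ↦ f y • W y) (.smul hf hW))
    (congr : ∀ W Z hW (h : ∀ᶠ y in 𝓝 x, Z y = W y), P W hW → P Z (hW.congr h))
    (hW : ContMDiffAlongAt m k φ W x) : P W hW := by
  classical
  obtain ⟨f, u, hf, hfu⟩ := hW.exists_eventually_eq_sum
  have hφ := hW.contMDiffAt_base
  have hu (i) := contMDiffAlongAt_coordField_comp hφ hk (u i)
  have hsum (s : Finset (Fin n)) :
      ContMDiffAlongAt m k φ (fun y ↦ ∑ i ∈ s, f i y • Biminimal.coordField (u i) (φ y)) x :=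
    .sum hφ fun i _ ↦ (hu i).smul (hf i)
  suffices h : ∀ s, P _ (hsum s) from congr _ _ _ hfu (h Finset.univ)
  intro s
  induction s using Finset.induction_on with
  | empty =>
    simpa using smul (fun _ ↦ 0) _ contMDiffAt_const _
      (coordField 0 (contMDiffAlongAt_coordField_comp hφ hk 0))
  | insert i s hi ih =>
    simp only [Finset.sum_insert hi]
    exact add _ _ _ _ (smul _ _ (hf i) _ (coordField _ (hu i))) ih

lemma ContMDiffAlongAt.contMDiffAt_inner [RiemannianBundle (fun q : N ↦ TangentSpace (𝓡 n) q)]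
    [IsContMDiffRiemannianBundle (𝓡 n) ∞ (EuclideanSpace ℝ (Fin n))
      (fun q : N ↦ TangentSpace (𝓡 n) q)] (hk : k ≤ ∞)
    (hW : ContMDiffAlongAt m k φ W x) (hZ : ContMDiffAlongAt m k φ Z x) :
    ContMDiffAt (𝓡 m) 𝓘(ℝ) k (fun y ↦ (inner ℝ (W y) (Z y) : ℝ)) x := by
  have : IsContMDiffRiemannianBundle (𝓡 n) k (EuclideanSpace ℝ (Fin n))
    (fun q : N ↦ TangentSpace (𝓡 n) q) := .of_le (n := ∞) hk
  exact ContMDiffAt.inner_bundle (b := φ) hW hZ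

end SectionsAlongMaps

section Christoffel

variable {n : ℕ} {N : Type*} [TopologicalSpace N] [ChartedSpace (EuclideanSpace ℝ (Fin n)) N]
  [IsManifold (𝓡 n) ∞ N] [RiemannianBundle (fun q : N ↦ TangentSpace (𝓡 n) q)] {q : N}

lemma metricDeriv_comm (u w z : TangentSpace (𝓡 n) q) : metricDeriv u w z = metricDeriv u z w := by
  simp only [metricDeriv, real_inner_comm]

lemma metricDeriv_add_left (u u' w z : TangentSpace (𝓡 n) q) :
    metricDeriv (u + u') w z = metricDeriv u w z + metricDeriv u' w z := by
  simp only [metricDeriv, map_add]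

lemma metricDeriv_smul_left (c : ℝ) (u w z : TangentSpace (𝓡 n) q) :
    metricDeriv (c • u) w z = c * metricDeriv u w z := by
  simp only [metricDeriv, map_smul, smul_eq_mul]

variable [IsContMDiffRiemannianBundle (𝓡 n) ∞ (EuclideanSpace ℝ (Fin n))
    (fun q : N ↦ TangentSpace (𝓡 n) q)]

lemma mdifferentiableAt_inner_coordField (w z : TangentSpace (𝓡 n) q) :
    MDifferentiableAt (𝓡 n) 𝓘(ℝ)
      (fun p : N ↦ (inner ℝ (coordField w p) (coordField z p) : ℝ)) q := by
  have h (u : TangentSpace (𝓡 n) q) : ContMDiffAlongAt n 1 (fun p ↦ p) (coordField u) q :=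
    contMDiffAlongAt_coordField u (by simp) (mem_chart_source _ q)
  exact ((h w).contMDiffAt_inner (by simp) (h z)).mdifferentiableAt (by simp)

lemma metricDeriv_add_right (u w z z' : TangentSpace (𝓡 n) q) :
    metricDeriv u w (z + z') = metricDeriv u w z + metricDeriv u w z' := by
  have hsum : (fun p : N ↦ (inner ℝ (coordField w p) (coordField (z + z') p) : ℝ)) =ᶠ[𝓝 q]
      fun p ↦ inner ℝ (coordField w p) (coordField z p)
        + inner ℝ (coordField w p) (coordField z' p) := by
    filter_upwards [eventually_mem_chartAt_source (n := n) (φ := fun p : N ↦ p) continuousAt_id]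
      with p hp
    rw [coordField_add _ _ hp, inner_add_right]
  rw [metricDeriv, mvfderiv_congr hsum, mvfderiv_fun_add (mdifferentiableAt_inner_coordField _ _)
    (mdifferentiableAt_inner_coordField _ _), add_apply, metricDeriv, metricDeriv]

lemma metricDeriv_smul_right (c : ℝ) (u w z : TangentSpace (𝓡 n) q) :
    metricDeriv u w (c • z) = c * metricDeriv u w z := by
  have hsmul : (fun p : N ↦ (inner ℝ (coordField w p) (coordField (c • z) p) : ℝ)) =ᶠ[𝓝 q]
      fun p ↦ c * inner ℝ (coordField w p) (coordField z p) := by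
    filter_upwards [eventually_mem_chartAt_source (n := n) (φ := fun p : N ↦ p) continuousAt_id]
      with p hp
    rw [coordField_smul _ _ hp, real_inner_smul_right]
  rw [metricDeriv, mvfderiv_congr hsmul, mvfderiv_fun_mul mdifferentiableAt_const
    (mdifferentiableAt_inner_coordField _ _), mvfderiv_const]
  simp [metricDeriv]

lemma metricDeriv_add_middle (u w w' z : TangentSpace (𝓡 n) q) :
    metricDeriv u (w + w') z = metricDeriv u w z + metricDeriv u w' z := by
  simp only [metricDeriv_comm u _ z, metricDeriv_add_right]

lemma metricDeriv_smul_middle (c : ℝ) (u w z : TangentSpace (𝓡 n) q) :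
    metricDeriv u (c • w) z = c * metricDeriv u w z := by
  simp only [metricDeriv_comm u _ z, metricDeriv_smul_right]

lemma inner_christoffel (u w z : TangentSpace (𝓡 n) q) :
    inner ℝ (christoffel u w) z
      = (metricDeriv u w z + metricDeriv w u z - metricDeriv z u w) / 2 := by
  let koszul : TangentSpace (𝓡 n) q →ₗ[ℝ] ℝ :=
    { toFun z := (metricDeriv u w z + metricDeriv w u z - metricDeriv z u w) / 2
      map_add' z z' := by simp only [metricDeriv_add_left, metricDeriv_add_right]; ring
      map_smul' c z := by
        simp only [metricDeriv_smul_left, metricDeriv_smul_right, RingHom.id_apply, smul_eq_mul]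
        ring }
  let e := stdOrthonormalBasis ℝ (TangentSpace (𝓡 n) q)
  calc inner ℝ (christoffel u w) z = ∑ k, koszul (e k) * inner ℝ (e k) z := by
        simp only [christoffel, sum_inner, real_inner_smul_left]; rfl
    _ = koszul (∑ k, inner ℝ (e k) z • e k) := by
        simp only [map_sum, map_smul, smul_eq_mul, mul_comm (koszul _)]
    _ = koszul z := congrArg koszul (e.sum_repr' z)

lemma christoffel_comm (u w : TangentSpace (𝓡 n) q) : christoffel u w = christoffel w u := by
  refine ext_inner_right ℝ fun z ↦ ?_
  rw [inner_christoffel, inner_christoffel, metricDeriv_comm z]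
  ring

lemma christoffel_add_left (u u' w : TangentSpace (𝓡 n) q) :
    christoffel (u + u') w = christoffel u w + christoffel u' w := by
  refine ext_inner_right ℝ fun z ↦ ?_
  simp only [inner_add_left, inner_christoffel, metricDeriv_add_left, metricDeriv_add_middle]
  ring

lemma christoffel_smul_left (c : ℝ) (u w : TangentSpace (𝓡 n) q) :
    christoffel (c • u) w = c • christoffel u w := by
  refine ext_inner_right ℝ fun z ↦ ?_
  simp only [real_inner_smul_left, inner_christoffel, metricDeriv_smul_left,
    metricDeriv_smul_middle]
  ring

lemma christoffel_add_right (u w w' : TangentSpace (𝓡 n) q) :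
    christoffel u (w + w') = christoffel u w + christoffel u w' := by
  simp only [christoffel_comm u, christoffel_add_left]

lemma christoffel_smul_right (c : ℝ) (u w : TangentSpace (𝓡 n) q) :
    christoffel u (c • w) = c • christoffel u w := by
  simp only [christoffel_comm u, christoffel_smul_left]

lemma metricDeriv_eq_inner_christoffel (u w z : TangentSpace (𝓡 n) q) :
    metricDeriv u w z = inner ℝ (christoffel u w) z + inner ℝ w (christoffel u z) := by
  rw [real_inner_comm _ w, inner_christoffel, inner_christoffel, metricDeriv_comm u z,
    metricDeriv_comm z u w, metricDeriv_comm w u z]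
  ring

end Christoffel

section InducedConnection

variable {n : ℕ} {N : Type*} [TopologicalSpace N] [ChartedSpace (EuclideanSpace ℝ (Fin n)) N]
  {m : ℕ} {M : Type*} [TopologicalSpace M] [ChartedSpace (EuclideanSpace ℝ (Fin m)) M]
  {φ : M → N} {x : M}

lemma mvfderiv_comp_eq_mvfderiv_mfderiv {F : Type*} [NormedAddCommGroup F] [NormedSpace ℝ F]
    {g : N → F} (hg : MDifferentiableAt (𝓡 n) 𝓘(ℝ, F) g (φ x))
    (hφ : MDifferentiableAt (𝓡 m) (𝓡 n) φ x) (v : TangentSpace (𝓡 m) x) :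
    mvfderiv (𝓡 m) (fun y ↦ g (φ y)) x v
      = mvfderiv (𝓡 n) g (φ x) (mfderiv (𝓡 m) (𝓡 n) φ x v) :=
  mfderiv_comp_apply x hg hφ v

lemma mfderiv_id_apply {q : N} (u : TangentSpace (𝓡 n) q) :
    mfderiv (𝓡 n) (𝓡 n) (fun p : N ↦ p) q u = u :=
  congrArg (· u) (mfderiv_id (I := 𝓡 n) (x := q))

variable [IsManifold (𝓡 n) ∞ N] [RiemannianBundle (fun q : N ↦ TangentSpace (𝓡 n) q)]
  {W Z : ∀ y : M, TangentSpace (𝓡 n) (φ y)}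

lemma covDerivAlong_eq (v : TangentSpace (𝓡 m) x) :
    covDerivAlong φ W v = chartVec (φ x) (φ x)
        (mvfderiv (𝓡 m) (fun y : M ↦ chartCoord (φ x) (φ y) (W y)) x v)
      + christoffel (mfderiv (𝓡 m) (𝓡 n) φ x v) (W x) := rfl

lemma leviCivita_eq {Y : ∀ p : N, TangentSpace (𝓡 n) p} {q : N} (u : TangentSpace (𝓡 n) q) :
    leviCivita Y u = chartVec q q (mvfderiv (𝓡 n) (fun p : N ↦ chartCoord q p (Y p)) q u)
      + christoffel u (Y q) := by
  rw [leviCivita, covDerivAlong_eq, mfderiv_id_apply]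

lemma covDerivAlong_congr (h : ∀ᶠ y in 𝓝 x, W y = Z y) (v : TangentSpace (𝓡 m) x) :
    covDerivAlong φ W v = covDerivAlong φ Z v := by
  have hcoord : (fun y ↦ chartCoord (φ x) (φ y) (W y)) =ᶠ[𝓝 x]
      fun y ↦ chartCoord (φ x) (φ y) (Z y) := h.mono fun y hy ↦ by simp only [hy]
  rw [covDerivAlong_eq, covDerivAlong_eq, mvfderiv_congr hcoord, h.self_of_nhds]

lemma leviCivita_coordField {q : N} (u w : TangentSpace (𝓡 n) q) :
    leviCivita (coordField w) u = christoffel u w := by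
  have hcoord : (fun p : N ↦ chartCoord q p (coordField w p)) =ᶠ[𝓝 q]
      fun _ ↦ chartCoord q q w := by
    filter_upwards [(chartAt (EuclideanSpace ℝ (Fin n)) q).open_source.mem_nhds
      (mem_chart_source _ q)] with p hp
    exact chartCoord_coordField w hp
  rw [leviCivita_eq, mvfderiv_congr hcoord, mvfderiv_const, coordField_self, zero_apply, map_zero,
    zero_add]

lemma covDerivAlong_comp {Y : ∀ p : N, TangentSpace (𝓡 n) p}
    (hY : ContMDiffAlongAt n 1 (fun p : N ↦ p) Y (φ x)) (hφ : MDifferentiableAt (𝓡 m) (𝓡 n) φ x)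
    (v : TangentSpace (𝓡 m) x) :
    covDerivAlong φ (fun y ↦ Y (φ y)) v = leviCivita Y (mfderiv (𝓡 m) (𝓡 n) φ x v) := by
  rw [covDerivAlong_eq, leviCivita_eq, mvfderiv_comp_eq_mvfderiv_mfderiv
    (g := fun p ↦ chartCoord (φ x) p (Y p)) (hY.contMDiffAt_chartCoord.mdifferentiableAt (by simp))
    hφ]

variable [IsContMDiffRiemannianBundle (𝓡 n) ∞ (EuclideanSpace ℝ (Fin n))
    (fun q : N ↦ TangentSpace (𝓡 n) q)]

lemma covDerivAlong_add_right (u v : TangentSpace (𝓡 m) x) :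
    covDerivAlong φ W (u + v) = covDerivAlong φ W u + covDerivAlong φ W v := by
  simp only [covDerivAlong_eq, map_add, christoffel_add_left]
  abel

lemma covDerivAlong_smul_right (c : ℝ) (v : TangentSpace (𝓡 m) x) :
    covDerivAlong φ W (c • v) = c • covDerivAlong φ W v := by
  simp only [covDerivAlong_eq, map_smul, christoffel_smul_left, smul_add]

lemma covDerivAlong_add (hW : ContMDiffAlongAt m 1 φ W x) (hZ : ContMDiffAlongAt m 1 φ Z x)
    (v : TangentSpace (𝓡 m) x) :
    covDerivAlong φ (fun y ↦ W y + Z y) v = covDerivAlong φ W v + covDerivAlong φ Z v := by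
  simp only [covDerivAlong_eq, map_add, christoffel_add_right]
  rw [mvfderiv_fun_add (hW.contMDiffAt_chartCoord.mdifferentiableAt (by simp))
    (hZ.contMDiffAt_chartCoord.mdifferentiableAt (by simp)), add_apply, map_add]
  abel

lemma covDerivAlong_smul {f : M → ℝ} (hf : ContMDiffAt (𝓡 m) 𝓘(ℝ) 1 f x)
    (hW : ContMDiffAlongAt m 1 φ W x) (v : TangentSpace (𝓡 m) x) :
    covDerivAlong φ (fun y ↦ f y • W y) v
      = f x • covDerivAlong φ W v + mvfderiv (𝓡 m) f x v • W x := by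
  simp only [covDerivAlong_eq, map_smul, christoffel_smul_right]
  rw [mvfderiv_fun_smul (hf.mdifferentiableAt (by simp))
    (hW.contMDiffAt_chartCoord.mdifferentiableAt (by simp))]
  simp only [add_apply, smul_apply, ContinuousLinearMap.smulRight_apply, map_add, map_smul,
    chartVec_chartCoord (mem_chart_source _ (φ x)), smul_add]
  abel

lemma mvfderiv_inner_of_coordField (v : TangentSpace (𝓡 m) x) (hZ : ContMDiffAlongAt m 1 φ Z x)
    (h : ∀ u : TangentSpace (𝓡 n) (φ x),
      mvfderiv (𝓡 m) (fun y ↦ (inner ℝ (coordField u (φ y)) (Z y) : ℝ)) x v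
        = inner ℝ (covDerivAlong φ (fun y ↦ coordField u (φ y)) v) (Z x)
          + inner ℝ (coordField u (φ x)) (covDerivAlong φ Z v))
    (hW : ContMDiffAlongAt m 1 φ W x) :
    mvfderiv (𝓡 m) (fun y ↦ (inner ℝ (W y) (Z y) : ℝ)) x v
      = inner ℝ (covDerivAlong φ W v) (Z x) + inner ℝ (W x) (covDerivAlong φ Z v) := by
  have hinner {W : ∀ y : M, TangentSpace (𝓡 n) (φ y)} (hW : ContMDiffAlongAt m 1 φ W x) :=
    (hW.contMDiffAt_inner (by simp) hZ).mdifferentiableAt (by simp)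
  induction W, hW using ContMDiffAlongAt.induction (k := 1) (hk := by simp) with
  | coordField u => exact h u
  | add W W' hW hW' ihW ihW' =>
    simp only [inner_add_left]
    rw [mvfderiv_fun_add (hinner hW) (hinner hW'), add_apply, ihW, ihW', covDerivAlong_add hW hW',
      inner_add_left]
    ring
  | smul f W hf hW ih =>
    simp only [real_inner_smul_left]
    rw [mvfderiv_fun_mul (hf.mdifferentiableAt (by simp)) (hinner hW), add_apply, smul_apply,
      smul_apply, ih, covDerivAlong_smul hf hW, inner_add_left, real_inner_smul_left,
      real_inner_smul_left, smul_eq_mul, smul_eq_mul]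
    ring
  | congr W W' _ hWW' ih =>
    have hinner' : (fun y ↦ (inner ℝ (W' y) (Z y) : ℝ)) =ᶠ[𝓝 x] fun y ↦ inner ℝ (W y) (Z y) :=
      hWW'.mono fun y hy ↦ by simp only [hy]
    rw [mvfderiv_congr hinner', ih, covDerivAlong_congr hWW', hWW'.self_of_nhds]

lemma mvfderiv_inner (hW : ContMDiffAlongAt m 1 φ W x) (hZ : ContMDiffAlongAt m 1 φ Z x)
    (v : TangentSpace (𝓡 m) x) :
    mvfderiv (𝓡 m) (fun y ↦ (inner ℝ (W y) (Z y) : ℝ)) x v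
      = inner ℝ (covDerivAlong φ W v) (Z x) + inner ℝ (W x) (covDerivAlong φ Z v) := by
  have hφ : MDifferentiableAt (𝓡 m) (𝓡 n) φ x := hW.contMDiffAt_base.mdifferentiableAt (by simp)
  have hcoord (u : TangentSpace (𝓡 n) (φ x)) :=
    contMDiffAlongAt_coordField (k := 1) u (by simp) (mem_chart_source _ (φ x))
  refine mvfderiv_inner_of_coordField v hZ (fun u ↦ ?_) hW
  simp only [real_inner_comm (Z _)]
  rw [add_comm, mvfderiv_inner_of_coordField v
    (contMDiffAlongAt_coordField_comp hZ.contMDiffAt_base (by simp) u) (fun w ↦ ?_) hZ,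
    real_inner_comm (covDerivAlong φ Z v)]
  rw [covDerivAlong_comp (hcoord _) hφ, covDerivAlong_comp (hcoord _) hφ, leviCivita_coordField,
    leviCivita_coordField, coordField_self, coordField_self, ← metricDeriv_eq_inner_christoffel]
  exact mvfderiv_comp_eq_mvfderiv_mfderiv (mdifferentiableAt_inner_coordField w u) hφ v

variable [IsManifold (𝓡 m) ∞ M]

lemma covDerivAlong_mfderiv_coordField_comm {q p : M} (hφ : ContMDiffAt (𝓡 m) (𝓡 n) 2 φ p)
    (hp : p ∈ (chartAt (EuclideanSpace ℝ (Fin m)) q).source) (u v : TangentSpace (𝓡 m) q) :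
    covDerivAlong φ (fun y ↦ mfderiv (𝓡 m) (𝓡 n) φ y (coordField u y)) (coordField v p)
      = covDerivAlong φ (fun y ↦ mfderiv (𝓡 m) (𝓡 n) φ y (coordField v y)) (coordField u p) := by
  let ψ : M → EuclideanSpace ℝ (Fin n) := fun y ↦ extChartAt (𝓡 n) (φ p) (φ y)
  have hψ : ContMDiffAt (𝓡 m) 𝓘(ℝ, EuclideanSpace ℝ (Fin n)) 2 ψ p :=
    ContMDiffAt.comp p (contMDiffAt_extChartAt.of_le (n := ∞) ENat.LEInfty.out) hφ
  have hcoord (w : TangentSpace (𝓡 m) q) :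
      (fun y ↦ chartCoord (φ p) (φ y) (mfderiv (𝓡 m) (𝓡 n) φ y (coordField w y))) =ᶠ[𝓝 p]
        fun y ↦ mvfderiv (𝓡 m) ψ y (coordField w y) := by
    filter_upwards [(contMDiffAt_iff_contMDiffAt_nhds (by simp)).1 hφ,
      eventually_mem_chartAt_source (n := n) hφ.continuousAt] with y hy hyp
    rw [mvfderiv_comp_eq_mvfderiv_mfderiv (mdifferentiableAt_extChartAt hyp)
      (hy.mdifferentiableAt (by simp)), chartCoord,
      TangentBundle.continuousLinearMapAt_trivializationAt hyp]
    rfl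
  rw [covDerivAlong_eq, covDerivAlong_eq, mvfderiv_congr (hcoord u), mvfderiv_congr (hcoord v),
    mvfderiv_mvfderiv_coordField_comm hψ hp, christoffel_comm]

end InducedConnection

section LeviCivita

variable {n : ℕ} {N : Type*} [TopologicalSpace N] [ChartedSpace (EuclideanSpace ℝ (Fin n)) N]
  [IsManifold (𝓡 n) ∞ N] [RiemannianBundle (fun q : N ↦ TangentSpace (𝓡 n) q)]
  [IsContMDiffRiemannianBundle (𝓡 n) ∞ (EuclideanSpace ℝ (Fin n))
    (fun q : N ↦ TangentSpace (𝓡 n) q)] {q p : N}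

lemma leviCivita_coordField_comm (hp : p ∈ (chartAt (EuclideanSpace ℝ (Fin n)) q).source)
    (u w : TangentSpace (𝓡 n) q) :
    leviCivita (coordField w) (coordField u p) = leviCivita (coordField u) (coordField w p) := by
  have h := covDerivAlong_mfderiv_coordField_comm (φ := fun p : N ↦ p) contMDiffAt_id hp w u
  simp only [mfderiv_id_apply] at h
  exact h

lemma inner_leviCivita_coordField (hp : p ∈ (chartAt (EuclideanSpace ℝ (Fin n)) q).source)
    (u w z : TangentSpace (𝓡 n) q) :
    inner ℝ (leviCivita (coordField w) (coordField u p)) (coordField z p)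
      = (mvfderiv (𝓡 n) (fun p : N ↦ (inner ℝ (coordField w p) (coordField z p) : ℝ)) p
            (coordField u p)
          + mvfderiv (𝓡 n) (fun p : N ↦ (inner ℝ (coordField u p) (coordField z p) : ℝ)) p
            (coordField w p)
          - mvfderiv (𝓡 n) (fun p : N ↦ (inner ℝ (coordField u p) (coordField w p) : ℝ)) p
            (coordField z p)) / 2 := by
  have hcoord (u : TangentSpace (𝓡 n) q) := contMDiffAlongAt_coordField (k := 1) u (by simp) hp
  have hmetric (u w z : TangentSpace (𝓡 n) q) :
      mvfderiv (𝓡 n) (fun p : N ↦ (inner ℝ (coordField w p) (coordField z p) : ℝ)) p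
        (coordField u p) = inner ℝ (leviCivita (coordField w) (coordField u p)) (coordField z p)
          + inner ℝ (coordField w p) (leviCivita (coordField z) (coordField u p)) :=
    mvfderiv_inner (hcoord w) (hcoord z) _
  rw [hmetric, hmetric, hmetric, leviCivita_coordField_comm hp w u,
    leviCivita_coordField_comm hp z u, leviCivita_coordField_comm hp z w,
    real_inner_comm (coordField z p), real_inner_comm (coordField w p) (leviCivita _ _)]
  ring

end LeviCivita

section OrthonormalFrames

variable {n : ℕ} {N : Type*} [TopologicalSpace N] [ChartedSpace (EuclideanSpace ℝ (Fin n)) N]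

lemma finrank_tangentSpace (q : N) : Module.finrank ℝ (TangentSpace (𝓡 n) q) = n :=
  finrank_euclideanSpace_fin

variable [IsManifold (𝓡 n) ∞ N]

lemma linearIndependent_coordField {q p : N} {ι : Type*} {u : ι → TangentSpace (𝓡 n) q}
    (hp : p ∈ (chartAt (EuclideanSpace ℝ (Fin n)) q).source) (hu : LinearIndependent ℝ u) :
    LinearIndependent ℝ (fun i ↦ coordField (u i) p) := by
  simp only [coordField_eq_chartVec _ hp]
  exact (hu.map_injOn (chartCoord q q).toLinearMap
    (Function.LeftInverse.injective (chartVec_chartCoord (mem_chart_source _ q))).injOn).map_injOn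
    (chartVec q p).toLinearMap (Function.LeftInverse.injective (chartCoord_chartVec hp)).injOn

variable [RiemannianBundle (fun q : N ↦ TangentSpace (𝓡 n) q)]
  [IsContMDiffRiemannianBundle (𝓡 n) ∞ (EuclideanSpace ℝ (Fin n))
    (fun q : N ↦ TangentSpace (𝓡 n) q)]
  {m : ℕ} {M : Type*} [TopologicalSpace M] [ChartedSpace (EuclideanSpace ℝ (Fin m)) M]
  {φ : M → N} {x : M} {k : WithTop ℕ∞}

section GramSchmidt

open InnerProductSpace

variable {ι : Type*} [LinearOrder ι] [LocallyFiniteOrderBot ι] [WellFoundedLT ι]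
  {V : ι → ∀ y : M, TangentSpace (𝓡 n) (φ y)}

lemma ContMDiffAlongAt.gramSchmidt (hk : k ≤ ∞) (hφ : ContMDiffAt (𝓡 m) (𝓡 n) k φ x)
    (hV : ∀ i, ContMDiffAlongAt m k φ (V i) x) (hli : LinearIndependent ℝ (fun i ↦ V i x))
    (i : ι) : ContMDiffAlongAt m k φ (fun y ↦ gramSchmidt ℝ (fun j ↦ V j y) i) x := by
  induction i using WellFoundedLT.induction with
  | ind i ih =>
    rw [funext fun y ↦ gramSchmidt_def ℝ (fun j ↦ V j y) i]
    refine (hV i).sub (.sum hφ fun j hj ↦ ?_)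
    have hj := ih j (Finset.mem_Iio.1 hj)
    simp only [Submodule.starProjection_singleton, RCLike.ofReal_real_eq_id, id,
      ← real_inner_self_eq_norm_sq]
    exact .smul ((hj.contMDiffAt_inner hk (hV i)).div₀ (hj.contMDiffAt_inner hk hj)
      (inner_self_ne_zero.2 (gramSchmidt_ne_zero j hli))) hj

end GramSchmidt

lemma ContMDiffAlongAt.normalize {W : ∀ y : M, TangentSpace (𝓡 n) (φ y)} (hk : k ≤ ∞)
    (hW : ContMDiffAlongAt m k φ W x) (hx : W x ≠ 0) :
    ContMDiffAlongAt m k φ (fun y ↦ ‖W y‖⁻¹ • W y) x := by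
  refine .smul ?_ hW
  have hne : (inner ℝ (W x) (W x) : ℝ) ≠ 0 := inner_self_ne_zero.2 hx
  simp only [norm_eq_sqrt_real_inner]
  exact ContMDiffAt.inv₀ ((Real.contDiffAt_sqrt hne).contMDiffAt.comp x
    (hW.contMDiffAt_inner hk hW)) (Real.sqrt_ne_zero'.2 (real_inner_self_pos.2 hx))

lemma exists_orthonormalFrame (q : N) :
    ∃ G : Fin n → ∀ p : N, TangentSpace (𝓡 n) p,
      (∀ i, ContMDiffAlongAt n ∞ (fun p : N ↦ p) (G i) q) ∧
        ∀ᶠ p in 𝓝 q, ∃ e : OrthonormalBasis (Fin n) ℝ (TangentSpace (𝓡 n) p), ∀ i, e i = G i p := by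
  let b := Module.finBasisOfFinrankEq ℝ (TangentSpace (𝓡 n) q) (finrank_tangentSpace q)
  have hli {p : N} (hp : p ∈ (chartAt (EuclideanSpace ℝ (Fin n)) q).source) :=
    linearIndependent_coordField hp b.linearIndependent
  have hq := mem_chart_source (EuclideanSpace ℝ (Fin n)) q
  refine ⟨fun i p ↦ InnerProductSpace.gramSchmidtNormed ℝ (fun j ↦ coordField (b j) p) i,
    fun i ↦ ?_, ?_⟩
  · exact (ContMDiffAlongAt.gramSchmidt le_rfl contMDiffAt_id
      (fun j ↦ contMDiffAlongAt_coordField (b j) le_rfl hq) (hli hq) i).normalize le_rfl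
      (InnerProductSpace.gramSchmidt_ne_zero i (hli hq))
  · filter_upwards [(chartAt _ q).open_source.mem_nhds hq] with p hp
    have hort := InnerProductSpace.gramSchmidtNormed_orthonormal (hli hp)
    have hspan := hort.linearIndependent.span_eq_top_of_card_eq_finrank'
      (by rw [finrank_tangentSpace, Fintype.card_fin])
    exact ⟨.mk hort hspan.ge, fun i ↦ by simp only [OrthonormalBasis.coe_mk]⟩

lemma contMDiffAlongAt_of_inner_coordField {W : ∀ y : M, TangentSpace (𝓡 n) (φ y)}
    (hφ : ContMDiffAt (𝓡 m) (𝓡 n) ∞ φ x)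
    (h : ∀ u : TangentSpace (𝓡 n) (φ x),
      ContMDiffAt (𝓡 m) 𝓘(ℝ) ∞ (fun y ↦ (inner ℝ (coordField u (φ y)) (W y) : ℝ)) x) :
    ContMDiffAlongAt m ∞ φ W x := by
  have hinner {V : ∀ y : M, TangentSpace (𝓡 n) (φ y)} (hV : ContMDiffAlongAt m ∞ φ V x) :
      ContMDiffAt (𝓡 m) 𝓘(ℝ) ∞ (fun y ↦ (inner ℝ (V y) (W y) : ℝ)) x := by
    induction V, hV using ContMDiffAlongAt.induction (k := ∞) (hk := le_rfl) with
    | coordField u => exact h u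
    | add V V' _ _ ihV ihV' => simp only [inner_add_left]; exact ihV.add ihV'
    | smul f V hf _ ih => simp only [real_inner_smul_left]; exact hf.mul ih
    | congr V V' _ hVV' ih =>
      exact ih.congr_of_eventuallyEq (hVV'.mono fun y hy ↦ by simp only [hy])
  obtain ⟨G, hG, hbasis⟩ := exists_orthonormalFrame (n := n) (φ x)
  have hGφ (i : Fin n) : ContMDiffAlongAt m ∞ φ (fun y ↦ G i (φ y)) x := (hG i).comp hφ
  refine (ContMDiffAlongAt.sum (s := Finset.univ) hφ
    fun i _ ↦ (hGφ i).smul (hinner (hGφ i))).congr ?_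
  filter_upwards [hφ.continuousAt.eventually hbasis] with y ⟨e, he⟩
  simp only [← he, e.sum_repr']

end OrthonormalFrames

section SmoothCovariantDerivatives

variable {n : ℕ} {N : Type*} [TopologicalSpace N] [ChartedSpace (EuclideanSpace ℝ (Fin n)) N]
  {m : ℕ} {M : Type*} [TopologicalSpace M] [ChartedSpace (EuclideanSpace ℝ (Fin m)) M]
  {φ : M → N} {x : M} {k l : WithTop ℕ∞}
  {X : ∀ y : M, TangentSpace (𝓡 m) y}

lemma contMDiffAt_mvfderiv [IsManifold (𝓡 m) ∞ M] (hk : k + 1 ≤ l) {f : M → ℝ}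
    (hf : ContMDiffAt (𝓡 m) 𝓘(ℝ) l f x) (hX : ContMDiffAlongAt m k (fun y : M ↦ y) X x) :
    ContMDiffAt (𝓡 m) 𝓘(ℝ) k (fun y ↦ mvfderiv (𝓡 m) f y (X y)) x := by
  have h := ContMDiffAt.clm_apply_of_inCoordinates (b₁ := fun y : M ↦ y) (b₂ := f) (m₀ := x)
    (F₁ := EuclideanSpace ℝ (Fin m)) (E₁ := fun y : M ↦ TangentSpace (𝓡 m) y)
    (F₂ := ℝ) (E₂ := fun t : ℝ ↦ TangentSpace 𝓘(ℝ) t) (IB₂ := 𝓘(ℝ))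
    (hf.mfderiv_const hk) hX (hf.of_le (le_self_add.trans hk))
  have h' := (contMDiffAt_totalSpace.1 h).2
  simp only [_root_.trivializationAt_model_space_apply] at h'
  exact h'

variable [IsManifold (𝓡 n) ∞ N]

lemma contMDiffAlongAt_mfderiv [IsManifold (𝓡 m) ∞ M] (hk : k + 1 ≤ l)
    (hφ : ContMDiffAt (𝓡 m) (𝓡 n) l φ x) (hX : ContMDiffAlongAt m k (fun y : M ↦ y) X x) :
    ContMDiffAlongAt m k φ (fun y ↦ mfderiv (𝓡 m) (𝓡 n) φ y (X y)) x :=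
  ContMDiffAt.clm_apply_of_inCoordinates (b₁ := fun y : M ↦ y) (b₂ := φ) (m₀ := x)
    (hφ.mfderiv_const hk) hX (hφ.of_le (le_self_add.trans hk))

lemma contMDiffAlongAt_mfderiv_coordField [IsManifold (𝓡 m) ∞ M]
    (hφ : ContMDiffAt (𝓡 m) (𝓡 n) 2 φ x) (v : TangentSpace (𝓡 m) x) :
    ContMDiffAlongAt m 1 φ (fun y ↦ mfderiv (𝓡 m) (𝓡 n) φ y (coordField v y)) x :=
  contMDiffAlongAt_mfderiv one_add_one_eq_two.le hφ
    (contMDiffAlongAt_coordField v (by simp) (mem_chart_source _ x))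

variable [RiemannianBundle (fun q : N ↦ TangentSpace (𝓡 n) q)]
  [IsContMDiffRiemannianBundle (𝓡 n) ∞ (EuclideanSpace ℝ (Fin n))
    (fun q : N ↦ TangentSpace (𝓡 n) q)]

lemma contMDiffAlongAt_leviCivita_coordField {q : N} (u w : TangentSpace (𝓡 n) q) :
    ContMDiffAlongAt n ∞ (fun p : N ↦ p)
      (fun p ↦ leviCivita (coordField w) (coordField u p)) q := by
  refine contMDiffAlongAt_of_inner_coordField contMDiffAt_id fun z ↦ ?_
  have hcoord (u : TangentSpace (𝓡 n) q) :=
    contMDiffAlongAt_coordField (k := ∞) u le_rfl (mem_chart_source _ q)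
  have hmetric (u w z : TangentSpace (𝓡 n) q) :
      ContMDiffAt (𝓡 n) 𝓘(ℝ) ∞ (fun p ↦ mvfderiv (𝓡 n)
        (fun p : N ↦ (inner ℝ (coordField w p) (coordField z p) : ℝ)) p (coordField u p)) q :=
    contMDiffAt_mvfderiv (l := ∞) (by simp)
      ((hcoord w).contMDiffAt_inner le_rfl (hcoord z)) (hcoord u)
  refine ContMDiffAt.congr_of_eventuallyEq
    ((((hmetric u w z).add (hmetric w u z)).sub (hmetric z u w)).div_const 2) ?_
  filter_upwards [(chartAt (EuclideanSpace ℝ (Fin n)) q).open_source.mem_nhds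
    (mem_chart_source _ q)] with p hp
  rw [real_inner_comm, inner_leviCivita_coordField hp]
  rfl

lemma contMDiffAlongAt_leviCivita_coordField_comp (hφ : ContMDiffAt (𝓡 m) (𝓡 n) ∞ φ x)
    {V : ∀ y : M, TangentSpace (𝓡 n) (φ y)} (hV : ContMDiffAlongAt m ∞ φ V x)
    (w : TangentSpace (𝓡 n) (φ x)) :
    ContMDiffAlongAt m ∞ φ (fun y ↦ leviCivita (coordField w) (V y)) x := by
  induction V, hV using ContMDiffAlongAt.induction (k := ∞) (hk := le_rfl) with
  | coordField u => exact (contMDiffAlongAt_leviCivita_coordField u w).comp hφ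
  | add V V' _ _ ihV ihV' => simpa only [leviCivita, covDerivAlong_add_right] using ihV.add ihV'
  | smul f V hf _ ih => simpa only [leviCivita, covDerivAlong_smul_right] using ih.smul hf
  | congr V V' _ hVV' ih => exact ih.congr (hVV'.mono fun y hy ↦ by simp only [hy])

lemma contMDiffAlongAt_covDerivAlong [IsManifold (𝓡 m) ∞ M]
    {W : ∀ y : M, TangentSpace (𝓡 n) (φ y)}
    (hφ : ContMDiffAt (𝓡 m) (𝓡 n) ∞ φ x) (hW : ContMDiffAlongAt m ∞ φ W x)
    (hX : ContMDiffAlongAt m ∞ (fun y : M ↦ y) X x) :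
    ContMDiffAlongAt m ∞ φ (fun y ↦ covDerivAlong φ W (X y)) x := by
  have heventually {V : ∀ y : M, TangentSpace (𝓡 n) (φ y)} (hV : ContMDiffAlongAt m ∞ φ V x) :=
    (hV.of_le (l := 1) (by simp)).eventually
  induction W, hW using ContMDiffAlongAt.induction (k := ∞) (hk := le_rfl) with
  | coordField w hw =>
    refine (contMDiffAlongAt_leviCivita_coordField_comp hφ
      (contMDiffAlongAt_mfderiv (l := ∞) (by simp) hφ hX) w).congr ?_
    filter_upwards [eventually_mem_chartAt_source (n := n) hφ.continuousAt, heventually hw]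
      with y hy hwy
    exact covDerivAlong_comp (contMDiffAlongAt_coordField w (by simp) hy)
      (hwy.contMDiffAt_base.mdifferentiableAt (by simp)) _
  | add W Z hW hZ ihW ihZ =>
    refine (ihW.add ihZ).congr ?_
    filter_upwards [heventually hW, heventually hZ] with y hWy hZy
    exact covDerivAlong_add hWy hZy _
  | smul f W hf hW ih =>
    have hf₁ : ContMDiffAt (𝓡 m) 𝓘(ℝ) 1 f x := hf.of_le (by simp)
    refine ((ih.smul hf).add (hW.smul (contMDiffAt_mvfderiv (l := ∞) (by simp) hf hX))).congr ?_
    filter_upwards [heventually hW, (contMDiffAt_iff_contMDiffAt_nhds (by simp)).1 hf₁]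
      with y hWy hfy
    exact covDerivAlong_smul hfy hWy _
  | congr W Z _ hWZ ih =>
    exact ih.congr ((eventually_eventually_nhds.2 hWZ).mono fun y hy ↦ covDerivAlong_congr hy _)

end SmoothCovariantDerivatives

lemma sum_apply_orthonormalBasis_eq {V W ι κ : Type*} [NormedAddCommGroup V]
    [InnerProductSpace ℝ V] [AddCommGroup W] [Module ℝ W] [Fintype ι] [Fintype κ]
    (B : V →ₗ[ℝ] V →ₗ[ℝ] W) (e : OrthonormalBasis ι ℝ V) (f : OrthonormalBasis κ ℝ V) :
    ∑ i, B (e i) (e i) = ∑ j, B (f j) (f j) := by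
  have : FiniteDimensional ℝ V := e.toBasis.finiteDimensional_of_finite
  have h := congrArg (TensorProduct.lift B)
    ((InnerProductSpace.canonicalCovariantTensor_eq_sum V e).symm.trans
      (InnerProductSpace.canonicalCovariantTensor_eq_sum V f))
  simpa only [map_sum, TensorProduct.lift.tmul] using h

section SecondFundamentalForm

variable {m n : ℕ}
  {M : Type*} [TopologicalSpace M] [ChartedSpace (EuclideanSpace ℝ (Fin m)) M]
  [IsManifold (𝓡 m) ∞ M] [RiemannianBundle (fun x : M ↦ TangentSpace (𝓡 m) x)]
  {N : Type*} [TopologicalSpace N] [ChartedSpace (EuclideanSpace ℝ (Fin n)) N]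
  [IsManifold (𝓡 n) ∞ N] [RiemannianBundle (fun q : N ↦ TangentSpace (𝓡 n) q)]
  {φ : M → N} {x : M} {Y Z : ∀ y : M, TangentSpace (𝓡 m) y}

/-- The difference `∇^φ_u dφ(Y) - dφ(∇_u Y)` of the Gauss formula for a vector field `Y`. It turns
out to depend only on the value of `Y` at the base point of `u`. -/
def gaussDifference (φ : M → N) (Y : ∀ y : M, TangentSpace (𝓡 m) y) {x : M}
    (u : TangentSpace (𝓡 m) x) : TangentSpace (𝓡 n) (φ x) :=
  covDerivAlong φ (fun y ↦ mfderiv (𝓡 m) (𝓡 n) φ y (Y y)) u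
    - mfderiv (𝓡 m) (𝓡 n) φ x (leviCivita Y u)

lemma gaussDifference_congr (h : ∀ᶠ y in 𝓝 x, Y y = Z y) (u : TangentSpace (𝓡 m) x) :
    gaussDifference (n := n) φ Y u = gaussDifference φ Z u := by
  rw [gaussDifference, leviCivita, covDerivAlong_congr h,
    covDerivAlong_congr (h.mono fun y hy ↦ by rw [hy])]
  rfl

variable [IsContMDiffRiemannianBundle (𝓡 m) ∞ (EuclideanSpace ℝ (Fin m))
    (fun x : M ↦ TangentSpace (𝓡 m) x)]
  [IsContMDiffRiemannianBundle (𝓡 n) ∞ (EuclideanSpace ℝ (Fin n))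
    (fun q : N ↦ TangentSpace (𝓡 n) q)]

lemma gaussDifference_add (hφ : ContMDiffAt (𝓡 m) (𝓡 n) 2 φ x)
    (hY : ContMDiffAlongAt m 1 (fun y : M ↦ y) Y x) (hZ : ContMDiffAlongAt m 1 (fun y : M ↦ y) Z x)
    (u : TangentSpace (𝓡 m) x) :
    gaussDifference (n := n) φ (fun y ↦ Y y + Z y) u
      = gaussDifference φ Y u + gaussDifference φ Z u := by
  simp only [gaussDifference, leviCivita, map_add]
  rw [covDerivAlong_add (contMDiffAlongAt_mfderiv one_add_one_eq_two.le hφ hY)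
    (contMDiffAlongAt_mfderiv one_add_one_eq_two.le hφ hZ), covDerivAlong_add hY hZ, map_add]
  abel

lemma gaussDifference_smul (hφ : ContMDiffAt (𝓡 m) (𝓡 n) 2 φ x) {f : M → ℝ}
    (hf : ContMDiffAt (𝓡 m) 𝓘(ℝ) 1 f x) (hY : ContMDiffAlongAt m 1 (fun y : M ↦ y) Y x)
    (u : TangentSpace (𝓡 m) x) :
    gaussDifference (n := n) φ (fun y ↦ f y • Y y) u = f x • gaussDifference φ Y u := by
  simp only [gaussDifference, leviCivita, map_smul]
  rw [covDerivAlong_smul hf (contMDiffAlongAt_mfderiv one_add_one_eq_two.le hφ hY),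
    covDerivAlong_smul hf hY, map_add, map_smul, map_smul, smul_sub]
  abel

variable (x) in
/-- The second fundamental form at `x` as a bilinear map. -/
def secondFundamentalFormₗ (hφ : ContMDiffAt (𝓡 m) (𝓡 n) 2 φ x) :
    TangentSpace (𝓡 m) x →ₗ[ℝ] TangentSpace (𝓡 m) x →ₗ[ℝ] TangentSpace (𝓡 n) (φ x) :=
  have hcoord (v : TangentSpace (𝓡 m) x) :
      ContMDiffAlongAt m 1 (fun y : M ↦ y) (coordField v) x :=
    contMDiffAlongAt_coordField v (by simp) (mem_chart_source _ x)
  have hsource := (chartAt (EuclideanSpace ℝ (Fin m)) x).open_source.mem_nhds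
    (mem_chart_source _ x)
  LinearMap.mk₂ ℝ (secondFundamentalForm φ)
    (fun u u' v ↦ by
      simp only [secondFundamentalForm, leviCivita, covDerivAlong_add_right, map_add]
      abel)
    (fun c u v ↦ by
      simp only [secondFundamentalForm, leviCivita, covDerivAlong_smul_right, map_smul, smul_sub])
    (fun u v v' ↦ (gaussDifference_congr
        (by filter_upwards [hsource] with y hy using coordField_add v v' hy) u).trans
      (gaussDifference_add hφ (hcoord v) (hcoord v') u))
    (fun c u v ↦ (gaussDifference_congr
        (by filter_upwards [hsource] with y hy using coordField_smul c v hy) u).trans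
      (gaussDifference_smul hφ contMDiffAt_const (hcoord v) u))

lemma gaussDifference_eq_secondFundamentalForm (hφ : ContMDiffAt (𝓡 m) (𝓡 n) 2 φ x)
    (hY : ContMDiffAlongAt m 1 (fun y : M ↦ y) Y x) (u : TangentSpace (𝓡 m) x) :
    gaussDifference (n := n) φ Y u = secondFundamentalForm φ u (Y x) := by
  change _ = secondFundamentalFormₗ x hφ u (Y x)
  induction Y, hY using ContMDiffAlongAt.induction (k := 1) (hk := by simp) with
  | coordField v => exact congrArg (secondFundamentalForm φ u) (coordField_self v).symm
  | add Y Z hY hZ ihY ihZ => rw [gaussDifference_add hφ hY hZ, ihY, ihZ, map_add]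
  | smul f Y hf hY ih => rw [gaussDifference_smul hφ hf hY, ih, map_smul]
  | congr Y Z _ hYZ ih => rw [gaussDifference_congr hYZ, ih, hYZ.self_of_nhds]

lemma secondFundamentalForm_comm (hφ : ContMDiffAt (𝓡 m) (𝓡 n) 2 φ x)
    (u v : TangentSpace (𝓡 m) x) :
    secondFundamentalForm (n := n) φ u v = secondFundamentalForm φ v u := by
  have h := covDerivAlong_mfderiv_coordField_comm hφ (mem_chart_source _ x) u v
  simp only [coordField_self] at h
  rw [secondFundamentalForm, secondFundamentalForm, leviCivita_coordField, leviCivita_coordField,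
    christoffel_comm, h]

lemma inner_secondFundamentalForm_mfderiv_anticomm (hφ : IsIsometricImmersion m n φ)
    (u v z : TangentSpace (𝓡 m) x) :
    (inner ℝ (secondFundamentalForm φ u v) (mfderiv (𝓡 m) (𝓡 n) φ x z) : ℝ)
      = -inner ℝ (secondFundamentalForm φ u z) (mfderiv (𝓡 m) (𝓡 n) φ x v) := by
  have hφx : ContMDiffAt (𝓡 m) (𝓡 n) 2 φ x := (hφ.contMDiff x).of_le ENat.LEInfty.out
  have hcoord (v : TangentSpace (𝓡 m) x) :
      ContMDiffAlongAt m 1 (fun y : M ↦ y) (coordField v) x :=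
    contMDiffAlongAt_coordField v (by simp) (mem_chart_source _ x)
  have hM := mvfderiv_inner (hcoord v) (hcoord z) u
  have hN := mvfderiv_inner (contMDiffAlongAt_mfderiv_coordField hφx v)
    (contMDiffAlongAt_mfderiv_coordField hφx z) u
  simp only [hφ.inner_mfderiv, coordField_self] at hM hN
  rw [hM, ← hφ.inner_mfderiv, ← hφ.inner_mfderiv x v] at hN
  simp only [secondFundamentalForm, inner_sub_left, leviCivita]
  rw [real_inner_comm _ (covDerivAlong φ (fun y ↦ mfderiv (𝓡 m) (𝓡 n) φ y (coordField z y)) u),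
    real_inner_comm (mfderiv (𝓡 m) (𝓡 n) φ x v) (mfderiv (𝓡 m) (𝓡 n) φ x _)]
  linarith

lemma inner_secondFundamentalForm_mfderiv (hφ : IsIsometricImmersion m n φ)
    (u v z : TangentSpace (𝓡 m) x) :
    (inner ℝ (secondFundamentalForm φ u v) (mfderiv (𝓡 m) (𝓡 n) φ x z) : ℝ) = 0 := by
  let b (u v z : TangentSpace (𝓡 m) x) : ℝ :=
    inner ℝ (secondFundamentalForm φ u v) (mfderiv (𝓡 m) (𝓡 n) φ x z)
  have hanti (u v z) : b u v z = -b u z v := inner_secondFundamentalForm_mfderiv_anticomm hφ u v z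
  have hsymm (u v z) : b u v z = b v u z := congrArg (inner ℝ · _)
    (secondFundamentalForm_comm ((hφ.contMDiff x).of_le ENat.LEInfty.out) u v)
  have hneg : b u v z = -b u v z := calc
    b u v z = -b u z v := hanti u v z
    _ = -b z u v := by rw [hsymm u z]
    _ = b z v u := by rw [hanti z u v, neg_neg]
    _ = b v z u := hsymm z v u
    _ = -b v u z := hanti v z u
    _ = -b u v z := by rw [hsymm v u]
  exact self_eq_neg.1 hneg

lemma meanCurvature_eq_sum {ι : Type*} [Fintype ι] (hφ : ContMDiffAt (𝓡 m) (𝓡 n) 2 φ x)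
    (e : OrthonormalBasis ι ℝ (TangentSpace (𝓡 m) x)) :
    meanCurvature m n φ x = (1 / (m : ℝ)) • ∑ i, secondFundamentalForm φ (e i) (e i) :=
  congrArg ((1 / (m : ℝ)) • ·) (sum_apply_orthonormalBasis_eq (secondFundamentalFormₗ x hφ) _ e)

lemma contMDiffAlongAt_gaussDifference (hφ : ContMDiffAt (𝓡 m) (𝓡 n) ∞ φ x)
    (hY : ContMDiffAlongAt m ∞ (fun y : M ↦ y) Y x) :
    ContMDiffAlongAt m ∞ φ (fun y ↦ gaussDifference (n := n) φ Y (Y y)) x :=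
  (contMDiffAlongAt_covDerivAlong hφ (contMDiffAlongAt_mfderiv (l := ∞) (by simp) hφ hY) hY).sub
    (contMDiffAlongAt_mfderiv (l := ∞) (by simp) hφ
      (contMDiffAlongAt_covDerivAlong contMDiffAt_id hY hY))

lemma contMDiffAlongAt_meanCurvature (hφ : ContMDiffAt (𝓡 m) (𝓡 n) ∞ φ x) :
    ContMDiffAlongAt m ∞ φ (meanCurvature m n φ) x := by
  obtain ⟨G, hG, hbasis⟩ := exists_orthonormalFrame (n := m) x
  have hsum : ContMDiffAlongAt m ∞ φ (fun y ↦ ∑ i, gaussDifference φ (G i) (G i y)) x :=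
    .sum hφ fun i _ ↦ contMDiffAlongAt_gaussDifference hφ (hG i)
  refine (hsum.smul (contMDiffAt_const (c := 1 / (m : ℝ)))).congr ?_
  have hG₁ (i : Fin m) : ContMDiffAlongAt m 1 (fun y : M ↦ y) (G i) x := (hG i).of_le (by simp)
  have hφ₂ : ContMDiffAt (𝓡 m) (𝓡 n) 2 φ x := hφ.of_le ENat.LEInfty.out
  filter_upwards [hbasis, eventually_all.2 fun i ↦ (hG₁ i).eventually,
    (contMDiffAt_iff_contMDiffAt_nhds (by simp)).1 hφ₂] with y ⟨e, he⟩ hGy hφy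
  simp only [meanCurvature_eq_sum hφy e, he, gaussDifference_eq_secondFundamentalForm hφy (hGy _)]

lemma inner_meanCurvature_mfderiv (hφ : IsIsometricImmersion m n φ) (z : TangentSpace (𝓡 m) x) :
    (inner ℝ (meanCurvature m n φ x) (mfderiv (𝓡 m) (𝓡 n) φ x z) : ℝ) = 0 := by
  rw [meanCurvature, real_inner_smul_left, sum_inner,
    Finset.sum_eq_zero fun i _ ↦ inner_secondFundamentalForm_mfderiv hφ _ _ _, mul_zero]

end SecondFundamentalForm

section MaximumPrinciple

variable {m n : ℕ}
  {M : Type*} [TopologicalSpace M] [ChartedSpace (EuclideanSpace ℝ (Fin m)) M]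
  [IsManifold (𝓡 m) ∞ M] [RiemannianBundle (fun x : M ↦ TangentSpace (𝓡 m) x)]
  {N : Type*} [TopologicalSpace N] [ChartedSpace (EuclideanSpace ℝ (Fin n)) N]
  [IsManifold (𝓡 n) ∞ N] [RiemannianBundle (fun q : N ↦ TangentSpace (𝓡 n) q)]
  {φ : M → N} {W : ∀ y : M, TangentSpace (𝓡 n) (φ y)} {x : M}

lemma inner_curvature_nonpos (hN : NonposSectionalCurvature n N) {q : N}
    {u v : TangentSpace (𝓡 n) q} (hu : u ≠ 0) (hv : v ≠ 0) (huv : (inner ℝ u v : ℝ) = 0) :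
    (inner ℝ (curvature u v v) u : ℝ) ≤ 0 := by
  have hli : LinearIndependent ℝ ![u, v] := by
    refine linearIndependent_of_ne_zero_of_inner_eq_zero (𝕜 := ℝ) (fun i ↦ ?_) fun i j hij ↦ ?_
    · fin_cases i <;> simpa
    · fin_cases i <;> fin_cases j <;> simp_all [real_inner_comm]
  have hsec := hN q u v hli
  rw [sectionalCurvature, huv, zero_pow two_ne_zero, sub_zero] at hsec
  have hpos : 0 < ‖u‖ ^ 2 * ‖v‖ ^ 2 := by positivity
  exact (div_le_iff₀ hpos).1 hsec |>.trans_eq (zero_mul _)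

variable [IsContMDiffRiemannianBundle (𝓡 n) ∞ (EuclideanSpace ℝ (Fin n))
  (fun q : N ↦ TangentSpace (𝓡 n) q)]

lemma inner_secondCovDerivAlong_add_norm_sq_nonpos (hφ : ContMDiff (𝓡 m) (𝓡 n) ∞ φ)
    (hW : ∀ y, ContMDiffAlongAt m ∞ φ W y) (hmax : IsLocalMax (fun y ↦ ‖W y‖ ^ 2) x)
    (v : TangentSpace (𝓡 m) x) :
    inner ℝ (secondCovDerivAlong φ W v v) (W x) + ‖covDerivAlong φ W v‖ ^ 2 ≤ 0 := by
  simp only [← real_inner_self_eq_norm_sq] at hmax ⊢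
  have hW₁ (y : M) : ContMDiffAlongAt m 1 φ W y := (hW y).of_le (by simp)
  have hDW : ContMDiffAlongAt m 1 φ (fun y ↦ covDerivAlong φ W (coordField v y)) x :=
    (contMDiffAlongAt_covDerivAlong (hφ x) (hW x)
      (contMDiffAlongAt_coordField v le_rfl (mem_chart_source _ x))).of_le (by simp)
  have hgrad (y : M) (u : TangentSpace (𝓡 m) y) :
      mvfderiv (𝓡 m) (fun y ↦ (inner ℝ (W y) (W y) : ℝ)) y u
        = 2 * inner ℝ (covDerivAlong φ W u) (W y) := by
    rw [mvfderiv_inner (hW₁ y) (hW₁ y), real_inner_comm (covDerivAlong φ W u)]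
    ring
  have hcritical : inner ℝ (covDerivAlong φ W (leviCivita (coordField v) v)) (W x) = (0 : ℝ) := by
    have h := hgrad x (leviCivita (coordField v) v)
    rw [mvfderiv_eq_zero_of_isLocalMax hmax] at h
    exact (mul_eq_zero_iff_left two_ne_zero).1 h.symm
  have hhess := mvfderiv_mvfderiv_nonpos_of_isLocalMax hmax
    (((hW x).contMDiffAt_inner le_rfl (hW x)).of_le ENat.LEInfty.out) v
  simp only [hgrad] at hhess
  rw [mvfderiv_fun_mul mdifferentiableAt_const
    ((hDW.contMDiffAt_inner (by simp) (hW₁ x)).mdifferentiableAt (by simp)), mvfderiv_const,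
    add_apply, smul_apply, mvfderiv_inner hDW (hW₁ x), coordField_self] at hhess
  simp only [smul_zero, zero_apply, add_zero, smul_eq_mul] at hhess
  rw [secondCovDerivAlong, inner_sub_left]
  linarith

lemma inner_laplacianAlong_add_sum_norm_sq_nonpos (hφ : ContMDiff (𝓡 m) (𝓡 n) ∞ φ)
    (hW : ∀ y, ContMDiffAlongAt m ∞ φ W y) (hmax : IsLocalMax (fun y ↦ ‖W y‖ ^ 2) x) :
    inner ℝ (laplacianAlong m n φ W x) (W x)
      + ∑ i, ‖covDerivAlong φ W (stdOrthonormalBasis ℝ (TangentSpace (𝓡 m) x) i)‖ ^ 2 ≤ 0 := by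
  rw [laplacianAlong, sum_inner, ← Finset.sum_add_distrib]
  exact Finset.sum_nonpos fun i _ ↦ inner_secondCovDerivAlong_add_norm_sq_nonpos hφ hW hmax _

variable [IsContMDiffRiemannianBundle (𝓡 m) ∞ (EuclideanSpace ℝ (Fin m))
  (fun x : M ↦ TangentSpace (𝓡 m) x)]

lemma inner_normalPart_meanCurvature (hφ : IsIsometricImmersion m n φ)
    (w : TangentSpace (𝓡 n) (φ x)) :
    (inner ℝ (normalPart m n φ x w) (meanCurvature m n φ x) : ℝ)
      = inner ℝ w (meanCurvature m n φ x) := by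
  have hnormal : meanCurvature m n φ x
      ∈ (LinearMap.range (mfderiv (𝓡 m) (𝓡 n) φ x).toLinearMap)ᗮ := by
    rw [Submodule.mem_orthogonal']
    rintro _ ⟨z, rfl⟩
    exact inner_meanCurvature_mfderiv hφ z
  rw [normalPart, Submodule.inner_starProjection_left_eq_right,
    Submodule.starProjection_eq_self_iff.2 hnormal]

lemma inner_curvature_meanCurvature_mfderiv_nonpos (hN : NonposSectionalCurvature n N)
    (hφ : IsIsometricImmersion m n φ) (hH : meanCurvature m n φ x ≠ 0)
    {v : TangentSpace (𝓡 m) x} (hv : v ≠ 0) :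
    (inner ℝ (curvature (meanCurvature m n φ x) (mfderiv (𝓡 m) (𝓡 n) φ x v)
      (mfderiv (𝓡 m) (𝓡 n) φ x v)) (meanCurvature m n φ x) : ℝ) ≤ 0 := by
  have hφv : mfderiv (𝓡 m) (𝓡 n) φ x v ≠ 0 := by
    rwa [← inner_self_ne_zero (𝕜 := ℝ), hφ.inner_mfderiv, inner_self_ne_zero]
  exact inner_curvature_nonpos hN hH hφv (inner_meanCurvature_mfderiv hφ v)

lemma inner_laplacianAlong_meanCurvature_nonneg (hN : NonposSectionalCurvature n N) {l : ℝ}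
    (hl : 0 ≤ l) (hφ : IsBiminimalSubmanifold m n φ l) (hH : meanCurvature m n φ x ≠ 0) :
    0 ≤ (inner ℝ (laplacianAlong m n φ (meanCurvature m n φ) x) (meanCurvature m n φ x) : ℝ) := by
  have heq := congrArg (fun w ↦ (inner ℝ w (meanCurvature m n φ x) : ℝ)) (hφ.biminimal_eq x)
  simp only [inner_add_left, inner_normalPart_meanCurvature hφ.isIsometricImmersion,
    inner_sub_left, inner_neg_left, sum_inner, real_inner_smul_left, inner_zero_left] at heq
  have hcurv := Finset.sum_nonpos fun i (_ : i ∈ Finset.univ) ↦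
    inner_curvature_meanCurvature_mfderiv_nonpos hN hφ.isIsometricImmersion hH
      ((stdOrthonormalBasis ℝ (TangentSpace (𝓡 m) x)).toBasis.ne_zero i)
  simp only [OrthonormalBasis.coe_toBasis] at hcurv
  have hlH : 0 ≤ l * (inner ℝ (meanCurvature m n φ x) (meanCurvature m n φ x) : ℝ) :=
    mul_nonneg hl real_inner_self_nonneg
  linarith

lemma inner_meanCurvature_secondFundamentalForm (hφ : IsIsometricImmersion m n φ)
    (u v : TangentSpace (𝓡 m) x) :
    (inner ℝ (meanCurvature m n φ x) (secondFundamentalForm φ u v) : ℝ)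
      = -inner ℝ (covDerivAlong φ (meanCurvature m n φ) u) (mfderiv (𝓡 m) (𝓡 n) φ x v) := by
  have hφx : ContMDiffAt (𝓡 m) (𝓡 n) ∞ φ x := hφ.contMDiff x
  have h := mvfderiv_inner ((contMDiffAlongAt_meanCurvature hφx).of_le (by simp))
    (contMDiffAlongAt_mfderiv_coordField (hφx.of_le ENat.LEInfty.out) v) u
  simp only [inner_meanCurvature_mfderiv hφ, mvfderiv_const, zero_apply, coordField_self] at h
  rw [secondFundamentalForm, inner_sub_right, inner_meanCurvature_mfderiv hφ]
  linarith

lemma meanCurvature_eq_zero_of_covDerivAlong_eq_zero (hφ : IsIsometricImmersion m n φ)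
    (h : ∀ i, covDerivAlong φ (meanCurvature m n φ)
      (stdOrthonormalBasis ℝ (TangentSpace (𝓡 m) x) i) = 0) : meanCurvature m n φ x = 0 := by
  rw [← inner_self_eq_zero (𝕜 := ℝ)]
  nth_rw 2 [meanCurvature]
  simp only [real_inner_smul_right, inner_sum, inner_meanCurvature_secondFundamentalForm hφ, h,
    inner_zero_left, neg_zero, Finset.sum_const_zero, mul_zero]

lemma meanCurvature_eq_zero_of_isLocalMax (hN : NonposSectionalCurvature n N) {l : ℝ}
    (hl : 0 ≤ l) (hφ : IsBiminimalSubmanifold m n φ l)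
    (hmax : IsLocalMax (fun y ↦ ‖meanCurvature m n φ y‖ ^ 2) x) : meanCurvature m n φ x = 0 := by
  have hiso := hφ.isIsometricImmersion
  by_contra hH
  have hbochner := inner_laplacianAlong_add_sum_norm_sq_nonpos hiso.contMDiff
    (fun y ↦ contMDiffAlongAt_meanCurvature (hiso.contMDiff y)) hmax
  have hlap := inner_laplacianAlong_meanCurvature_nonneg hN hl hφ hH
  have hsum : ∑ i, ‖covDerivAlong φ (meanCurvature m n φ)
      (stdOrthonormalBasis ℝ (TangentSpace (𝓡 m) x) i)‖ ^ 2 = 0 :=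
    le_antisymm (by linarith) (Finset.sum_nonneg fun _ _ ↦ sq_nonneg _)
  refine hH (meanCurvature_eq_zero_of_covDerivAlong_eq_zero hiso fun i ↦ ?_)
  rw [Finset.sum_eq_zero_iff_of_nonneg fun _ _ ↦ sq_nonneg _] at hsum
  exact norm_eq_zero.1 (sq_eq_zero_iff.1 (hsum i (Finset.mem_univ i)))

lemma exists_forall_norm_meanCurvature_le [CompactSpace M] [Nonempty M]
    (hφ : ContMDiff (𝓡 m) (𝓡 n) ∞ φ) :
    ∃ x₀, ∀ x, ‖meanCurvature m n φ x‖ ≤ ‖meanCurvature m n φ x₀‖ := by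
  have hcont : Continuous fun y ↦ ‖meanCurvature m n φ y‖ := by
    simp only [norm_eq_sqrt_real_inner]
    exact Real.continuous_sqrt.comp <| continuous_iff_continuousAt.2 fun y ↦
      ((contMDiffAlongAt_meanCurvature (hφ y)).contMDiffAt_inner le_rfl
        (contMDiffAlongAt_meanCurvature (hφ y))).continuousAt
  obtain ⟨x₀, -, hx₀⟩ := isCompact_univ.exists_isMaxOn Set.univ_nonempty hcont.continuousOn
  exact ⟨x₀, fun x ↦ hx₀ (Set.mem_univ x)⟩

end MaximumPrinciple

end Biminimal

end

theorem proposition3p5_general {m n : ℕ}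
    {M : Type*} [TopologicalSpace M]
    [ChartedSpace (EuclideanSpace ℝ (Fin m)) M] [IsManifold (𝓡 m) ∞ M]
    [RiemannianBundle (fun x : M ↦ TangentSpace (𝓡 m) x)]
    [IsContMDiffRiemannianBundle (𝓡 m) ∞ (EuclideanSpace ℝ (Fin m))
      (fun x : M ↦ TangentSpace (𝓡 m) x)]
    {N : Type*} [TopologicalSpace N]
    [ChartedSpace (EuclideanSpace ℝ (Fin n)) N] [IsManifold (𝓡 n) ∞ N]
    [RiemannianBundle (fun q : N ↦ TangentSpace (𝓡 n) q)]
    [IsContMDiffRiemannianBundle (𝓡 n) ∞ (EuclideanSpace ℝ (Fin n))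
      (fun q : N ↦ TangentSpace (𝓡 n) q)]
    (hN : Biminimal.NonposSectionalCurvature n N)
    (φ : M → N) (hφ : Biminimal.IsNonnegBiminimalSubmanifold m n φ) {x₀ : M}
    (hx₀ : ∀ x, ‖Biminimal.meanCurvature m n φ x‖ ≤ ‖Biminimal.meanCurvature m n φ x₀‖) :
    Biminimal.IsMinimal m n φ := by
  obtain ⟨l, hl, hb⟩ := hφ
  have hmax : IsLocalMax (fun x ↦ ‖Biminimal.meanCurvature m n φ x‖ ^ 2) x₀ :=
    .of_forall fun x ↦ pow_le_pow_left₀ (norm_nonneg _) (hx₀ x) 2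
  have hzero := Biminimal.meanCurvature_eq_zero_of_isLocalMax hN hl hb hmax
  exact fun x ↦ norm_le_zero_iff.1 ((hx₀ x).trans_eq (by rw [hzero, norm_zero]))

theorem proposition3p5 {m n : ℕ}
    {M : Type*} [TopologicalSpace M] [T2Space M] [CompactSpace M]
    [ChartedSpace (EuclideanSpace ℝ (Fin m)) M] [IsManifold (𝓡 m) ∞ M]
    [RiemannianBundle (fun x : M ↦ TangentSpace (𝓡 m) x)]
    [IsContMDiffRiemannianBundle (𝓡 m) ∞ (EuclideanSpace ℝ (Fin m))
      (fun x : M ↦ TangentSpace (𝓡 m) x)]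
    {N : Type*} [TopologicalSpace N] [T2Space N]
    [ChartedSpace (EuclideanSpace ℝ (Fin n)) N] [IsManifold (𝓡 n) ∞ N]
    [RiemannianBundle (fun q : N ↦ TangentSpace (𝓡 n) q)]
    [IsContMDiffRiemannianBundle (𝓡 n) ∞ (EuclideanSpace ℝ (Fin n))
      (fun q : N ↦ TangentSpace (𝓡 n) q)]
    (hN : Biminimal.NonposSectionalCurvature n N)
    (φ : M → N) (hφ : Biminimal.IsNonnegBiminimalSubmanifold m n φ) :
    Biminimal.IsMinimal m n φ := by
  intro x
  have : Nonempty M := ⟨x⟩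
  obtain ⟨l, hl, hb⟩ := hφ
  obtain ⟨x₀, hx₀⟩ :=
    Biminimal.exists_forall_norm_meanCurvature_le hb.isIsometricImmersion.contMDiff
  exact proposition3p5_general hN φ ⟨l, hl, hb⟩ hx₀ x
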